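/- **Market.** There are finitely many goods $t\in S$ and finitely many buyer types $i\in B$. Buyers of type $i$ form a continuum of total population $T_i\in(0,\infty]$, each wanting one unit of any good of a non-empty set $S_i\subseteq S$. Their inverse demand function $\lambda_i:[0,T_i)\to(0,\infty)$ ($\lambda_i(z)=v$ means that an amount $z$ of them has value at least $v$) is continuous, non-increasing, continuously differentiable on $(0,T_i)$ and has a monotone hazard rate: $\lambda_i'/\lambda_i$ is non-increasing on $(0,T_i)$. The peaks are uniform: $\lambda_i(0)=\lambda^{\max}>0$ for all $i$. Producing an amount $y$ of good $t$ costs $C_t(y)$, where $C_t:[0,\infty)\to[0,\infty)$ is convex and continuously differentiable with $C_t(0)=0$; put $c_t=C_t'$. **Solutions.** An allocation $(x,y)$ consists of demands $0\le x_i\le T_i$ ($x_i$ finite) and amounts $y_t(i)\ge 0$ with $\sum_t y_t(i)=x_i$ and $y_t(i)=0$ for $t\notin S_i$; put $y_t=\sum_i y_t(i)$. Its social welfare is $SW(x,y)=\sum_i\int_0^{x_i}\lambda_i(z)\,dz-\sum_t C_t(y_t)$. For prices $p\in\mathbb R^S$ let $\bar p_i=\min_{t\in S_i}p_t$. The triple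 $(p,x,y)$ is envy-free if $(x,y)$ is an allocation, $y_t(i)>0$ implies $p_t=\bar p_i$, and each $x_i$ is a best response to $\bar p_i$, i.e. $\lambda_i(z)\ge\bar p_i$ for $0\le z<x_i$ and $\lambda_i(z)\le\bar p_i$ for $x_i<z<T_i$ (for $0<x_i<T_i$: $\lambda_i(x_i)=\bar p_i$). Its revenue is $\sum_t(p_ty_t-C_t(y_t))$. **Ascending-price procedure with stop parameter $k$.** Let $(x^*,y^*)$ be an allocation of maximum social welfare (assumed to exist) and $p^*_t=c_t(y^*_t)$. Initially the prices are $p^*$, the allocation is $(x^*,y^*)$, and all goods and buyer types are inactive. The active price $p$ rises continuously, starting below all $p^*_t$, and all active goods are priced at $p$. At each $p$: (i) active buyer types demand a best response to $p$, served by a min-cost flow in the bipartite graph induced by the active goods and active buyer types, while all others keep their allocation; (ii) inactive goods with $p^*_t=p$, and the inactive buyer types using them, become active; (iii) active goods with $p-c_t(y_t)\ge\frac1k(\lambda^{\max}-c_t(y_t))$, and the active buyer types using them, become finished, their prices and allocations being frozen. The procedure stops when all goods are finished and returns the current prices and allocation. **Claim.** For $k=e$ the procedure can be carried out to its end from every welfare-maximizing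 $(x^*,y^*)$, and every solution $(p^e,x^e,y^e)$ that it can return (whatever best responses and min-cost flows are chosen) is envy-free. Moreover there is $\alpha\in[1,2]$ such that $$SW(x^e,y^e)=\frac1\alpha\,SW(x^*,y^*),$$ and for the same $\alpha$ the revenue of $(p^e,x^e,y^e)$ is at least $\max\left(\frac1e,\frac{\alpha-1}{\alpha}\right)$ times the optimal revenue, that is, at least this multiple of the revenue of every envy-free solution $(p,x,y)$. -/

import Mathlib

/-- A large market. `B` is the set of buyer types and `S` the set of goods. Buyers of type `i` want
one unit of any good of `desired i`; their total population is `pop i` (possibly infinite);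
`val i` is their inverse demand function: `val i z = v` means that an amount `z` of them
has value `v` or more. Only the values of `val i` on `[0, pop i)` are used.
Producing the amount `y ≥ 0` of good `t` costs `cost t y`. -/
structure Market (B S : Type*) where
  desired : B → Finset S
  desired_nonempty : ∀ i, (desired i).Nonempty
  pop : B → EReal
  val : B → ℝ → ℝ
  cost : S → ℝ → ℝ

namespace Market

section Basic

/-- The half-open interval `[0, pop i)`. -/
def dom {B S : Type*} (M : Market B S) (i : B) : Set ℝ :=
  {z | 0 ≤ z ∧ (z : EReal) < M.pop i}

/-- The open interval `(0, pop i)`. -/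
def openDom {B S : Type*} (M : Market B S) (i : B) : Set ℝ :=
  {z | 0 < z ∧ (z : EReal) < M.pop i}

/-- Standing assumptions on an inverse demand function: positive and non-increasing on
`[0, pop i)`, continuous there (this matters only at `0`), continuously differentiable on
`(0, pop i)`. -/
structure IsInverseDemand {B S : Type*} (M : Market B S) (i : B) : Prop where
  pop_pos : 0 < M.pop i
  pos : ∀ z ∈ M.dom i, 0 < M.val i z
  antitone : AntitoneOn (M.val i) (M.dom i)
  continuousOn : ContinuousOn (M.val i) (M.dom i)
  contDiffOn : ContDiffOn ℝ 1 (M.val i) (M.openDom i)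

/-- Monotone hazard rate: `λ' / λ` is non-increasing. -/
def IsMHR {B S : Type*} (M : Market B S) (i : B) : Prop :=
  AntitoneOn (fun z => deriv (M.val i) z / M.val i z) (M.openDom i)

/-- Uniform peak: `λ_i(0) = λmax` for all buyer types. -/
def HasUniformPeak {B S : Type*} (M : Market B S) (lam : ℝ) : Prop :=
  0 < lam ∧ ∀ i, M.val i 0 = lam

/-- Standing assumptions on a production cost: a nonnegative, convex, continuously differentiable
function on `[0, ∞)`; producing nothing is free. -/
structure IsProductionCost {B S : Type*} (M : Market B S) (t : S) : Prop where
  zero : M.cost t 0 = 0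
  nonneg : ∀ y, 0 ≤ y → 0 ≤ M.cost t y
  convexOn : ConvexOn ℝ (Set.Ici 0) (M.cost t)
  contDiffOn : ContDiffOn ℝ 1 (M.cost t) (Set.Ici 0)

/-- The marginal cost `c_t(y)`, for `y ≥ 0` (one-sided at `0`). -/
noncomputable def marginal {B S : Type*} (M : Market B S) (t : S) (y : ℝ) : ℝ :=
  derivWithin (M.cost t) (Set.Ici 0) y

/-- The total amount `y_t` of good `t` in the allocation `y`, where `y i t` is the amount
of good `t` given to buyers of type `i`. -/
def load {B S : Type*} [Fintype B] (y : B → S → ℝ) (t : S) : ℝ := ∑ i, y i t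

/-- The total production cost `C(y)`. -/
def totalCost {B S : Type*} [Fintype B] [Fintype S] (M : Market B S) (y : B → S → ℝ) : ℝ :=
  ∑ t, M.cost t (load y t)

/-- `y` is a feasible flow for the demand `x` in the subgraph induced by the buyer types `Bs` and
the goods `Ss`. -/
structure IsFlow {B S : Type*} [Fintype S] (M : Market B S) (Bs : Set B) (Ss : Set S)
    (x : B → ℝ) (y : B → S → ℝ) : Prop where
  nonneg : ∀ i t, 0 ≤ y i t
  total : ∀ i ∈ Bs, ∑ t, y i t = x i
  support : ∀ i t, y i t ≠ 0 → i ∈ Bs ∧ t ∈ Ss ∧ t ∈ M.desired i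

/-- `y` is a min-cost flow for the demand `x` in the subgraph induced by `Bs` and `Ss`. -/
def IsMinCostFlow {B S : Type*} [Fintype B] [Fintype S] (M : Market B S) (Bs : Set B) (Ss : Set S)
    (x : B → ℝ) (y : B → S → ℝ) : Prop :=
  M.IsFlow Bs Ss x y ∧ ∀ z, M.IsFlow Bs Ss x z → M.totalCost y ≤ M.totalCost z

/-- `(x, y)` is an allocation: `x i` is an amount of buyers of type `i`, and `y` is feasible
with `x`. -/
def IsAllocation {B S : Type*} [Fintype S] (M : Market B S) (x : B → ℝ) (y : B → S → ℝ) : Prop :=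
  (∀ i, 0 ≤ x i ∧ (x i : EReal) ≤ M.pop i) ∧ M.IsFlow Set.univ Set.univ x y

/-- Social welfare. -/
noncomputable def welfare {B S : Type*} [Fintype B] [Fintype S] (M : Market B S)
    (x : B → ℝ) (y : B → S → ℝ) : ℝ :=
  (∑ i, ∫ z in (0 : ℝ)..(x i), M.val i z) - M.totalCost y

/-- `(x, y)` maximizes social welfare over all allocations. -/
def IsWelfareOptimal {B S : Type*} [Fintype B] [Fintype S] (M : Market B S)
    (x : B → ℝ) (y : B → S → ℝ) : Prop :=
  M.IsAllocation x y ∧ ∀ x' y', M.IsAllocation x' y' → M.welfare x' y' ≤ M.welfare x y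

/-- The minimum price available to buyers of type `i`. -/
noncomputable def minPrice {B S : Type*} (M : Market B S) (p : S → ℝ) (i : B) : ℝ :=
  (M.desired i).inf' (M.desired_nonempty i) p

/-- The demand `a` of type `i` is a best response to the price `q`: all the buyers served value
the good at `q` or more, the others at `q` or less. For `0 < a < pop i` this says `λ_i(a) = q`
(`isBestResponse_iff` below); at the end points it says `λ_i(0) ≤ q` for `a = 0`,
and that `q` is at most all values of `λ_i` for `a = pop i`. -/
def IsBestResponse {B S : Type*} (M : Market B S) (i : B) (q a : ℝ) : Prop :=
  0 ≤ a ∧ (a : EReal) ≤ M.pop i ∧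
    (∀ z, 0 ≤ z → z < a → q ≤ M.val i z) ∧
    (∀ z, a < z → (z : EReal) < M.pop i → M.val i z ≤ q)

/-- The solution `(p, x, y)` is envy-free. -/
structure IsEnvyFree {B S : Type*} [Fintype S] (M : Market B S)
    (p : S → ℝ) (x : B → ℝ) (y : B → S → ℝ) : Prop where
  bestResponse : ∀ i, M.IsBestResponse i (M.minPrice p i) (x i)
  flow : M.IsFlow Set.univ Set.univ x y
  cheapest : ∀ i t, 0 < y i t → p t = M.minPrice p i

/-- The seller's revenue: payments minus production costs. -/
def revenue {B S : Type*} [Fintype B] [Fintype S] (M : Market B S)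
    (p : S → ℝ) (y : B → S → ℝ) : ℝ :=
  ∑ t, (p t * load y t - M.cost t (load y t))

end Basic

section BestResponse

theorem isBestResponse_iff {B S : Type*} (M : Market B S) (i : B) (h : M.IsInverseDemand i)
    (q a : ℝ) (ha : 0 < a) (ha' : (a : EReal) < M.pop i) :
    M.IsBestResponse i q a ↔ M.val i a = q := by
  have hmem : a ∈ M.openDom i := ⟨ha, ha'⟩
  have hdom : a ∈ M.dom i := ⟨ha.le, ha'⟩
  have hopen : IsOpen (M.openDom i) :=
    (isOpen_lt continuous_const continuous_id).inter
      (isOpen_lt continuous_coe_real_ereal continuous_const)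
  have hc : ContinuousAt (M.val i) a :=
    h.contDiffOn.continuousOn.continuousAt (hopen.mem_nhds hmem)
  constructor
  · rintro ⟨-, -, h1, h2⟩
    apply le_antisymm
    · refine le_of_tendsto (hc.tendsto.mono_left (nhdsWithin_le_nhds (s := Set.Ioi a))) ?_
      filter_upwards [self_mem_nhdsWithin, nhdsWithin_le_nhds (hopen.mem_nhds hmem)] with z hz hz'
      exact h2 z hz hz'.2
    · refine ge_of_tendsto (hc.tendsto.mono_left (nhdsWithin_le_nhds (s := Set.Iio a))) ?_
      filter_upwards [self_mem_nhdsWithin, nhdsWithin_le_nhds (hopen.mem_nhds hmem)] with z hz hz'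
      exact h1 z hz'.1.le hz
  · rintro rfl
    refine ⟨ha.le, ha'.le, fun z hz hza => ?_, fun z hza hz => ?_⟩
    · exact h.antitone ⟨hz, (EReal.coe_lt_coe_iff.2 hza).trans ha'⟩ hdom hza.le
    · exact h.antitone hdom ⟨ha.le.trans hza.le, hz⟩ hza.le

end BestResponse

section Algorithm

/-- The status of a good or of a buyer type in the ascending-price procedure. -/
inductive Phase
  | inactive
  | active
  | finished

/-- A state of the ascending-price procedure; `level` is the active price. -/
structure State (B S : Type*) where
  level : ℝ
  price : S → ℝ
  x : B → ℝ
  y : B → S → ℝ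
  item : S → Phase
  buyer : B → Phase

/-- The stopping criterion with parameter `k` for price `q` and marginal cost `c`. -/
def Stops (k lam q c : ℝ) : Prop := q - c ≥ 1 / k * (lam - c)

/-- The initial prices `p*_t = c_t(y*_t)`. -/
noncomputable def initialPrice {B S : Type*} [Fintype B] (M : Market B S) (ys : B → S → ℝ)
    (t : S) : ℝ :=
  M.marginal t (load ys t)

/-- The state before the procedure starts, at an active price `l` below all initial prices:
prices and allocation are those of the welfare optimum, everything is inactive. -/
noncomputable def startState {B S : Type*} [Fintype B] (M : Market B S)
    (xs : B → ℝ) (ys : B → S → ℝ) (l : ℝ) : State B S where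
  level := l
  price := M.initialPrice ys
  x := xs
  y := ys
  item := fun _ => Phase.inactive
  buyer := fun _ => Phase.inactive

/-- `(x, y)` is the solution when all active goods of the state `s` are priced at `r`: active buyers
best-respond to `r` and are served by a min-cost flow in the subgraph induced by the active
goods and buyers; all other buyers keep their allocation. -/
structure IsRepriced {B S : Type*} [Fintype B] [Fintype S] (M : Market B S) (s : State B S) (r : ℝ)
    (x : B → ℝ) (y : B → S → ℝ) : Prop where
  bestResponse : ∀ i, s.buyer i = Phase.active → M.IsBestResponse i r (x i)
  minCost : ∃ z, M.IsMinCostFlow {i | s.buyer i = Phase.active} {t | s.item t = Phase.active} x z ∧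
    ∀ i, s.buyer i = Phase.active → y i = z i
  frozen : ∀ i, s.buyer i ≠ Phase.active → x i = s.x i ∧ y i = s.y i

/-- Good `t` leaves the inactive set when the active price becomes `q`. (The price of an inactive
good is its initial price.) -/
def State.ItemJoins {B S : Type*} (s : State B S) (q : ℝ) (t : S) : Prop :=
  s.item t = Phase.inactive ∧ s.price t = q

/-- Buyer type `i` leaves the inactive set: it uses a good that does. -/
def State.BuyerJoins {B S : Type*} (s : State B S) (q : ℝ) (i : B) : Prop :=
  s.buyer i = Phase.inactive ∧ ∃ t, s.ItemJoins q t ∧ 0 < s.y i t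

/-- Good `t`, active or just activated, meets the stopping criterion in the current solution `y`
at the active price `q`. -/
def State.ItemStops {B S : Type*} [Fintype B] (s : State B S) (M : Market B S) (k lam q : ℝ)
    (y : B → S → ℝ) (t : S) : Prop :=
  (s.item t = Phase.active ∨ s.ItemJoins q t) ∧ Stops k lam q (M.marginal t (load y t))

/-- Buyer type `i`, active or just activated, uses a good that stops. -/
def State.BuyerStops {B S : Type*} [Fintype B] (s : State B S) (M : Market B S) (k lam q : ℝ)
    (y : B → S → ℝ) (i : B) : Prop :=
  (s.buyer i = Phase.active ∨ s.BuyerJoins q i) ∧ ∃ t, s.ItemStops M k lam q y t ∧ 0 < y i t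

/-- One stage of the continuous ascending-price procedure. The active price is raised from `s.level`
to `s'.level` without passing a price where an inactive good has to be activated or an active
good meets the stopping criterion. At the new active price the solution on the active subgraph is
recomputed; then the goods with this initial price are activated, with the buyers using them; then
all active goods that meet the stopping criterion become finished, with the buyers using them. -/
structure Step {B S : Type*} [Fintype B] [Fintype S] (M : Market B S) (k lam : ℝ)
    (s s' : State B S) : Prop where
  rise : s.level < s'.level
  no_join_between : ∀ r, s.level < r → r < s'.level → ∀ t, ¬ s.ItemJoins r t
  no_stop_between : ∀ r, s.level < r → r < s'.level → ∀ x y, M.IsRepriced s r x y →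
    ∀ t, s.item t = Phase.active → ¬ Stops k lam r (M.marginal t (load y t))
  repriced : M.IsRepriced s s'.level s'.x s'.y
  price_active : ∀ t, s.item t = Phase.active → s'.price t = s'.level
  price_other : ∀ t, s.item t ≠ Phase.active → s'.price t = s.price t
  item_inactive : ∀ t, s'.item t = Phase.inactive ↔
    s.item t = Phase.inactive ∧ ¬ s.ItemJoins s'.level t
  item_finished : ∀ t, s'.item t = Phase.finished ↔
    s.item t = Phase.finished ∨ s.ItemStops M k lam s'.level s'.y t
  buyer_inactive : ∀ i, s'.buyer i = Phase.inactive ↔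
    s.buyer i = Phase.inactive ∧ ¬ s.BuyerJoins s'.level i
  buyer_finished : ∀ i, s'.buyer i = Phase.finished ↔
    s.buyer i = Phase.finished ∨ s.BuyerStops M k lam s'.level s'.y i

/-- `s` is a final state of the ascending-price procedure with stop parameter `k`, started at the
welfare optimum `(xs, ys)`: finitely many stages lead to `s`, where all goods are finished. The
solution returned is `(s.price, s.x, s.y)`. -/
def IsReturned {B S : Type*} [Fintype B] [Fintype S] (M : Market B S) (k lam : ℝ)
    (xs : B → ℝ) (ys : B → S → ℝ) (s : State B S) : Prop :=
  (∃ l, (∀ t, l < M.initialPrice ys t) ∧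
    Relation.ReflTransGen (M.Step k lam) (M.startState xs ys l) s) ∧
  ∀ t, s.item t = Phase.finished

end Algorithm

end Market

/-! The procedure is governed by the invariant `State.IsConsistent`. It holds at the start because a
welfare optimum priced at marginal cost is envy-free (`IsWelfareOptimal.isEnvyFree`), and
`Step.isConsistent` preserves it. The main tool is a comparison of two min-cost flows in the same
graph (`IsEquilibrated.load_le_or_marginal_le`). It shows that the marginal costs of active goods
depend only on the active price, depend on it continuously, and do not increase as the price rises.
So an active good stops below the peak and with equality in the criterion (`Step.margin_eq`), while
a good that joins has margin zero and stops at once exactly when its price is at least the peak. The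
next event always exists by compactness, and each event moves some good to a later phase, so the
procedure ends.

At the end, price and marginal cost of every good satisfy `IsStopMargin`. Because the peak is
uniform, the marginal cost is then an increasing function of the price, so the cheapest good of a
type `i` also has the least marginal cost, `γ i`.

The monotone hazard rate makes `log λ` concave, and log-concavity survives subtracting a constant
cost `c` as long as the difference is positive. If the margin at `x` is `1 / e` of its peak `λmax -
c`, then beyond `x` the margin at `z` is at most `(λmax - c) * exp (-z / x)`. With `p` the price at
`x`, this yields two bounds for a single type: every other price earns at most `e` times the profit
`(p - c) * x` (`IsBestResponse.margin_mul_le`), and the welfare lost by serving only `x` is at most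
that profit (`IsBestResponse.integral_le`).

Apply both with `c = γ i` and sum over the types, linearizing the convex costs at the final loads.
This gives `R' ≤ e * R` for every envy-free revenue `R'`, and `W* - W ≤ R`, where `R`, `W` are the
final revenue and welfare and `W*` is the optimal welfare. Since envy-free revenue never exceeds
welfare, `R ≤ W`, so `α = W* / W` is at most `2`, and `R ≥ W* - W = (α - 1) / α * W* ≥ (α - 1) / α *
R'`. -/

namespace Market

open Set Filter Topology MeasureTheory

/-! ### Convex production costs and their marginals. -/

section Cost

variable {B S : Type*} {M : Market B S} {t : S}

theorem IsProductionCost.hasDerivWithinAt (h : M.IsProductionCost t) {a : ℝ} (ha : 0 ≤ a) :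
    HasDerivWithinAt (M.cost t) (M.marginal t a) (Ici 0) a :=
  ((h.contDiffOn.differentiableOn one_ne_zero) a ha).hasDerivWithinAt

theorem IsProductionCost.tangent_le (h : M.IsProductionCost t) {a b : ℝ} (ha : 0 ≤ a)
    (hb : 0 ≤ b) : M.cost t a + M.marginal t a * (b - a) ≤ M.cost t b := by
  rcases lt_trichotomy a b with hab | rfl | hab
  · have := h.convexOn.le_slope_of_hasDerivWithinAt ha hb hab (h.hasDerivWithinAt ha)
    rw [slope_def_field, le_div_iff₀ (sub_pos.2 hab)] at this
    linarith
  · simp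
  · have := h.convexOn.slope_le_of_hasDerivWithinAt hb ha hab (h.hasDerivWithinAt ha)
    rw [slope_def_field, div_le_iff₀ (sub_pos.2 hab)] at this
    linarith

theorem IsProductionCost.marginal_mono (h : M.IsProductionCost t) {a b : ℝ} (ha : 0 ≤ a)
    (hab : a ≤ b) : M.marginal t a ≤ M.marginal t b := by
  rcases hab.eq_or_lt with rfl | hlt
  · rfl
  have h1 := h.tangent_le ha (ha.trans hab)
  have h2 := h.tangent_le (ha.trans hab) ha
  by_contra! hc
  nlinarith

theorem IsProductionCost.continuousOn_marginal (h : M.IsProductionCost t) :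
    ContinuousOn (M.marginal t) (Ici 0) :=
  h.contDiffOn.continuousOn_derivWithin (uniqueDiffOn_Ici 0) le_rfl

theorem IsProductionCost.continuousOn_cost (h : M.IsProductionCost t) :
    ContinuousOn (M.cost t) (Ici 0) := h.contDiffOn.continuousOn

theorem IsProductionCost.marginal_nonneg (h : M.IsProductionCost t) {a : ℝ} (ha : 0 ≤ a) :
    0 ≤ M.marginal t a := by
  have hpos : ∀ b, 0 < b → 0 ≤ M.marginal t b := fun b hb => by
    have h1 := h.tangent_le hb.le le_rfl
    rw [h.zero] at h1
    by_contra! hc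
    nlinarith [h.nonneg b hb.le]
  rcases ha.eq_or_lt with rfl | hlt
  -- The tangent at `0` gives no lower bound on its own slope, so the sign at `0` is obtained as a
  -- limit from the right.
  · have hc : Tendsto (M.marginal t) (𝓝[>] 0) (𝓝 (M.marginal t 0)) :=
      (h.continuousOn_marginal 0 self_mem_Ici).tendsto.mono_left
        (nhdsWithin_mono _ Ioi_subset_Ici_self)
    exact ge_of_tendsto hc (by filter_upwards [self_mem_nhdsWithin] with b hb using hpos b hb)
  · exact hpos a hlt

theorem IsProductionCost.cost_le_marginal_mul (h : M.IsProductionCost t) {a : ℝ} (ha : 0 ≤ a) :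
    M.cost t a ≤ M.marginal t a * a := by
  have h1 := h.tangent_le ha le_rfl
  rw [h.zero] at h1
  linarith

/-- Continuity of marginal costs, along amounts cut off at `0`. -/
theorem IsProductionCost.tendsto_marginal_max (h : M.IsProductionCost t) {ι : Type*} {l : Filter ι}
    {a : ℝ} (ha : 0 ≤ a) {u : ι → ℝ} (hu : Tendsto u l (𝓝 a)) :
    Tendsto (fun j => M.marginal t (max (u j) 0)) l (𝓝 (M.marginal t a)) := by
  have h1 : Tendsto (fun j => max (u j) 0) l (𝓝 (max a 0)) := hu.max tendsto_const_nhds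
  rw [max_eq_left ha] at h1
  exact (h.continuousOn_marginal a ha).tendsto.comp
    (tendsto_nhdsWithin_iff.2 ⟨h1, Eventually.of_forall fun j => mem_Ici.2 (le_max_right _ _)⟩)

end Cost

/-! ### Inverse demand: log-concavity and integrals. -/

section Demand

variable {B S : Type*} {M : Market B S} {i : B}

theorem isOpen_openDom (M : Market B S) (i : B) : IsOpen (M.openDom i) :=
  (isOpen_lt continuous_const continuous_id).inter
    (isOpen_lt continuous_coe_real_ereal continuous_const)

theorem dom_of_le {a b : ℝ} (ha : 0 ≤ a) (hab : a ≤ b) (hb : (b : EReal) < M.pop i) :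
    a ∈ M.dom i := ⟨ha, (EReal.coe_le_coe_iff.2 hab).trans_lt hb⟩

theorem dom_of_lt {a b : ℝ} (ha : 0 ≤ a) (hab : a < b) (hb : (b : EReal) ≤ M.pop i) :
    a ∈ M.dom i := ⟨ha, (EReal.coe_lt_coe_iff.2 hab).trans_le hb⟩

theorem convex_dom (M : Market B S) (i : B) : Convex ℝ (M.dom i) := by
  refine OrdConnected.convex ⟨fun a ha b hb z hz => dom_of_le (ha.1.trans hz.1) hz.2 hb.2⟩

theorem interior_dom (M : Market B S) (i : B) : interior (M.dom i) = M.openDom i := by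
  refine Subset.antisymm (fun z hz => ?_)
    (interior_maximal (fun z hz => ⟨hz.1.le, hz.2⟩) (isOpen_openDom M i))
  have h1 : z ∈ interior (Ici (0 : ℝ)) := interior_mono (fun w hw => hw.1) hz
  rw [interior_Ici] at h1
  exact ⟨h1, (interior_subset hz).2⟩

theorem IsInverseDemand.zero_mem (h : M.IsInverseDemand i) : (0 : ℝ) ∈ M.dom i :=
  ⟨le_rfl, by exact_mod_cast h.pop_pos⟩

theorem IsInverseDemand.val_le_zero (h : M.IsInverseDemand i) {z : ℝ} (hz : z ∈ M.dom i) :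
    M.val i z ≤ M.val i 0 := h.antitone h.zero_mem hz hz.1

/-- The hazard-rate quotient `λ' / λ` is the derivative of `log λ`, and an antitone derivative means
concavity. -/
theorem IsInverseDemand.concaveOn_log (h : M.IsInverseDemand i) (hm : M.IsMHR i) :
    ConcaveOn ℝ (M.dom i) (fun z => Real.log (M.val i z)) := by
  have hdiff : ∀ z ∈ M.openDom i, DifferentiableAt ℝ (M.val i) z := fun z hz =>
    (h.contDiffOn.differentiableOn one_ne_zero).differentiableAt ((isOpen_openDom M i).mem_nhds hz)
  have hpos : ∀ z ∈ M.openDom i, M.val i z ≠ 0 := fun z hz => (h.pos z ⟨hz.1.le, hz.2⟩).ne'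
  apply AntitoneOn.concaveOn_of_deriv (convex_dom M i)
  · exact h.continuousOn.log fun z hz => (h.pos z hz).ne'
  · rw [interior_dom]
    exact fun z hz => ((hdiff z hz).log (hpos z hz)).differentiableWithinAt
  · rw [interior_dom]
    refine AntitoneOn.congr hm fun z hz => ?_
    exact (deriv.log (hdiff z hz) (hpos z hz)).symm

/-- Log-concavity between `0` and `z`. -/
theorem IsInverseDemand.rpow_mul_rpow_le (h : M.IsInverseDemand i) (hm : M.IsMHR i) {x z : ℝ}
    (hx : 0 ≤ x) (hxz : x ≤ z) (hz0 : 0 < z) (hz : z ∈ M.dom i) :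
    M.val i 0 ^ (1 - x / z) * M.val i z ^ (x / z) ≤ M.val i x := by
  have hxd : x ∈ M.dom i := dom_of_le hx hxz hz.2
  have h0 := h.pos 0 h.zero_mem
  have hzp := h.pos z hz
  have hs1 : x / z ≤ 1 := (div_le_one hz0).2 hxz
  have := (h.concaveOn_log hm).2 h.zero_mem hz (sub_nonneg.2 hs1) (by positivity : 0 ≤ x / z)
    (by ring)
  simp only [smul_eq_mul, mul_zero, zero_add, div_mul_cancel₀ _ hz0.ne'] at this
  rw [← Real.log_le_log_iff (by positivity) (h.pos x hxd), Real.log_mul (by positivity)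
    (by positivity), Real.log_rpow h0, Real.log_rpow hzp]
  exact this

/-- A log-concave function that has fallen below its value at `0` cannot become flat again. This
strictness is what makes best responses below the peak unique. -/
theorem IsInverseDemand.val_lt_val (h : M.IsInverseDemand i) (hm : M.IsMHR i) {a b : ℝ}
    (ha : 0 ≤ a) (hab : a < b) (hb : b ∈ M.dom i) (hlt : M.val i a < M.val i 0) :
    M.val i b < M.val i a := by
  have had : a ∈ M.dom i := dom_of_le ha hab.le hb.2
  refine lt_of_le_of_ne (h.antitone had hb hab.le) fun heq => ?_
  have h1 := h.rpow_mul_rpow_le hm ha hab.le (ha.trans_lt hab) hb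
  have h0 := h.pos 0 h.zero_mem
  have hap := h.pos a had
  have hs : 0 < 1 - a / b := sub_pos.2 ((div_lt_one (ha.trans_lt hab)).2 hab)
  rw [heq] at h1
  have h2 : M.val i a ^ (1 - a / b) < M.val i 0 ^ (1 - a / b) :=
    Real.rpow_lt_rpow hap.le hlt hs
  have h3 : M.val i a ^ (1 - a / b) * M.val i a ^ (a / b) = M.val i a := by
    rw [← Real.rpow_add hap]; simp
  have h4 := mul_lt_mul_of_pos_right h2 (by positivity : 0 < M.val i a ^ (a / b))
  linarith

/-- The end point `b` may equal the population, where `λ` carries no information; hence the open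
interval, on which `λ` is continuous and bounded by `λ 0`. -/
theorem IsInverseDemand.intervalIntegrable (h : M.IsInverseDemand i) {a b : ℝ} (ha : 0 ≤ a)
    (hab : a ≤ b) (hb : (b : EReal) ≤ M.pop i) : IntervalIntegrable (M.val i) volume a b := by
  rw [intervalIntegrable_iff_integrableOn_Ioo_of_le hab]
  have hsub : Ioo a b ⊆ M.dom i := fun z hz => dom_of_lt (ha.trans hz.1.le) hz.2 hb
  refine IntegrableOn.of_bound (by simp)
    ((h.continuousOn.mono hsub).aestronglyMeasurable measurableSet_Ioo) (M.val i 0) ?_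
  refine (ae_restrict_mem measurableSet_Ioo).mono fun z hz => ?_
  rw [Real.norm_eq_abs, abs_of_pos (h.pos z (hsub hz))]
  exact h.val_le_zero (hsub hz)

theorem IsInverseDemand.integral_le (h : M.IsInverseDemand i) {a b : ℝ} (ha : 0 ≤ a)
    (hab : a ≤ b) (hb : (b : EReal) ≤ M.pop i) {g : ℝ → ℝ} (hg : Continuous g)
    (hle : ∀ z, a < z → z < b → M.val i z ≤ g z) :
    ∫ z in a..b, M.val i z ≤ ∫ z in a..b, g z :=
  intervalIntegral.integral_mono_on_of_le_Ioo hab (h.intervalIntegrable ha hab hb)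
    (hg.intervalIntegrable _ _) fun z hz => hle z hz.1 hz.2

theorem IsInverseDemand.le_integral (h : M.IsInverseDemand i) {a b : ℝ} (ha : 0 ≤ a)
    (hab : a ≤ b) (hb : (b : EReal) ≤ M.pop i) {m : ℝ}
    (hle : ∀ z, a < z → z < b → m ≤ M.val i z) :
    m * (b - a) ≤ ∫ z in a..b, M.val i z := by
  have := intervalIntegral.integral_mono_on_of_le_Ioo (f := fun _ => m) (g := M.val i) hab
    (by simp) (h.intervalIntegrable ha hab hb) fun z hz => hle z hz.1 hz.2
  simpa [mul_comm] using this

theorem IsInverseDemand.integral_le_mul (h : M.IsInverseDemand i) {a b : ℝ} (ha : 0 ≤ a)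
    (hab : a ≤ b) (hb : (b : EReal) ≤ M.pop i) {m : ℝ}
    (hle : ∀ z, a < z → z < b → M.val i z ≤ m) :
    ∫ z in a..b, M.val i z ≤ m * (b - a) := by
  simpa [mul_comm] using h.integral_le ha hab hb (g := fun _ => m) continuous_const hle

theorem IsInverseDemand.integral_sub_integral (h : M.IsInverseDemand i) {a b : ℝ} (ha : 0 ≤ a)
    (hab : a ≤ b) (hb : (b : EReal) ≤ M.pop i) :
    (∫ z in (0 : ℝ)..b, M.val i z) - ∫ z in (0 : ℝ)..a, M.val i z = ∫ z in a..b, M.val i z :=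
  intervalIntegral.integral_interval_sub_left (h.intervalIntegrable le_rfl (ha.trans hab) hb)
    (h.intervalIntegrable le_rfl ha ((EReal.coe_le_coe_iff.2 hab).trans hb))

end Demand

end Market

namespace Market

open Set Filter Topology MeasureTheory

/-! ### Best responses: uniqueness, existence and continuity in the price. -/

section BestResponses

variable {B S : Type*} {M : Market B S} {i : B}

theorem IsBestResponse.pos (h : M.IsInverseDemand i) {q a : ℝ} (ha : M.IsBestResponse i q a)
    (hq : q < M.val i 0) : 0 < a := by
  refine lt_of_le_of_ne ha.1 fun h0 => ?_
  subst h0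
  have hc : Tendsto (M.val i) (𝓝[M.openDom i] 0) (𝓝 (M.val i 0)) :=
    (h.continuousOn 0 h.zero_mem).tendsto.mono_left
      (nhdsWithin_mono _ fun z hz => ⟨hz.1.le, hz.2⟩)
  have hne : (𝓝[M.openDom i] (0 : ℝ)).NeBot := by
    have hopen : IsOpen {z : ℝ | (z : EReal) < M.pop i} :=
      isOpen_lt continuous_coe_real_ereal continuous_const
    have : M.openDom i = Ioi 0 ∩ {z : ℝ | (z : EReal) < M.pop i} := rfl
    rw [this, nhdsWithin_inter_of_mem' (nhdsWithin_le_nhds (hopen.mem_nhds h.zero_mem.2))]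
    infer_instance
  have := le_of_tendsto hc (by
    filter_upwards [self_mem_nhdsWithin] with z hz using ha.2.2.2 z hz.1 hz.2)
  linarith

theorem IsBestResponse.le_of_le (h : M.IsInverseDemand i) (hm : M.IsMHR i) {q q' a a' : ℝ}
    (ha : M.IsBestResponse i q a) (ha' : M.IsBestResponse i q' a') (hqq : q ≤ q')
    (hq : q < M.val i 0) : a' ≤ a := by
  by_contra! hlt
  -- Two points `a < w < z < a'` are needed: the value is at most `q` at `w`, drops strictly up to
  -- `z`, and yet is at least `q' ≥ q` at `z`.
  obtain ⟨w, h1, hw⟩ := exists_between hlt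
  obtain ⟨z, h2, h3⟩ := exists_between hw
  have hz := dom_of_lt (ha.1.trans (h1.le.trans h2.le)) h3 ha'.2.1
  have hwd := dom_of_le (ha.1.trans h1.le) h2.le hz.2
  have hle := ha.2.2.2 w h1 hwd.2
  linarith [h.val_lt_val hm hwd.1 h2 hz (hle.trans_lt hq), ha'.2.2.1 z hz.1 h3]

theorem IsBestResponse.eq (h : M.IsInverseDemand i) (hm : M.IsMHR i) {q a a' : ℝ}
    (ha : M.IsBestResponse i q a) (ha' : M.IsBestResponse i q a') (hq : q < M.val i 0) : a = a' :=
  le_antisymm (ha'.le_of_le h hm ha le_rfl hq) (ha.le_of_le h hm ha' le_rfl hq)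

/-- A best response to a price yields a best response to every higher price below the peak. -/
theorem IsBestResponse.exists_of_le (h : M.IsInverseDemand i) {q r a : ℝ}
    (ha : M.IsBestResponse i q a) (hqr : q ≤ r) (hr : r ≤ M.val i 0) :
    ∃ a', M.IsBestResponse i r a' := by
  -- The new demand is the supremum of the amounts valued at `r` or more. The cut at `a` keeps the
  -- set bounded when the population is infinite and loses nothing, since values beyond `a` are at
  -- most `q ≤ r`.
  set A : Set ℝ := {z | z ≤ a ∧ z ∈ M.dom i ∧ r ≤ M.val i z}
  have h0 : (0 : ℝ) ∈ A := ⟨ha.1, h.zero_mem, hr⟩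
  have hbdd : BddAbove A := ⟨a, fun z hz => hz.1⟩
  have hsa : sSup A ≤ a := csSup_le ⟨0, h0⟩ fun z hz => hz.1
  refine ⟨sSup A, le_csSup hbdd h0, (EReal.coe_le_coe_iff.2 hsa).trans ha.2.1, fun z hz hlt => ?_,
    fun z hz hpop => ?_⟩
  · obtain ⟨w, hw, hzw⟩ := exists_lt_of_lt_csSup ⟨0, h0⟩ hlt
    exact hw.2.2.trans (h.antitone (dom_of_le hz hzw.le hw.2.1.2) hw.2.1 hzw.le)
  · by_contra! hc
    rcases le_or_gt z a with hza | hza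
    · exact absurd (le_csSup hbdd ⟨hza, ⟨(le_csSup hbdd h0).trans hz.le, hpop⟩, hc.le⟩) hz.not_ge
    · linarith [ha.2.2.2 z hza hpop]

/-- Best responses depend continuously on the price below the peak. -/
theorem continuousWithinAt_bestResponse (h : M.IsInverseDemand i) (hm : M.IsMHR i) {s : Set ℝ}
    {X : ℝ → ℝ} (hX : ∀ r ∈ s, M.IsBestResponse i r (X r)) {r : ℝ} (hr : r ∈ s)
    (hlt : r < M.val i 0) : ContinuousWithinAt X s r := by
  have hr' := hX r hr
  rw [Metric.continuousWithinAt_iff']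
  intro ε hε
  have hup : ∀ᶠ u in 𝓝[s] r, X u < X r + ε := by
    by_cases hpop : ((X r + ε / 2 : ℝ) : EReal) < M.pop i
    · set z := X r + ε / 2 with hz
      have hzd : z ∈ M.dom i := ⟨by linarith [hr'.1], hpop⟩
      -- At `X r + ε / 4` the value is at most `r`, which is below the peak, so it drops strictly on
      -- the way to `z`; the room left absorbs small price changes.
      have hval : M.val i z < r := by
        have hwd : X r + ε / 4 ∈ M.dom i :=
          dom_of_le (by linarith [hr'.1]) (by linarith : X r + ε / 4 ≤ z) hpop
        have h1 := hr'.2.2.2 _ (by linarith : X r < X r + ε / 4) hwd.2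
        linarith [h.val_lt_val hm hwd.1 (by linarith : X r + ε / 4 < z) hzd (h1.trans_lt hlt)]
      filter_upwards [self_mem_nhdsWithin, nhdsWithin_le_nhds (lt_mem_nhds hval)] with u hu hzu
      by_contra! hc
      linarith [(hX u hu).2.2.1 z hzd.1 (by linarith)]
    · filter_upwards [self_mem_nhdsWithin] with u hu
      by_contra! hc
      exact hpop (dom_of_lt (by linarith [hr'.1]) (by linarith) (hX u hu).2.1).2
  have hlow : ∀ᶠ u in 𝓝[s] r, X r - ε < X u := by
    by_cases hpos : 0 ≤ X r - ε / 2
    · have hzd : X r - ε / 2 ∈ M.dom i := dom_of_lt hpos (by linarith) hr'.2.1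
      have hval : r < M.val i (X r - ε / 2) := by
        -- Either the value has left the peak and is strictly decreasing, or it still equals the
        -- peak, which exceeds `r`.
        rcases lt_or_ge (M.val i (X r - ε / 2)) (M.val i 0) with hv | hv
        · have hwd : X r - ε / 4 ∈ M.dom i :=
            dom_of_lt (by linarith) (by linarith : X r - ε / 4 < X r) hr'.2.1
          linarith [h.val_lt_val hm hpos (by linarith : X r - ε / 2 < X r - ε / 4) hwd hv,
            hr'.2.2.1 _ hwd.1 (by linarith)]
        · linarith
      filter_upwards [self_mem_nhdsWithin, nhdsWithin_le_nhds (gt_mem_nhds hval)] with u hu hzu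
      by_contra! hc
      linarith [(hX u hu).2.2.2 _ (by linarith : X u < X r - ε / 2) hzd.2]
    · filter_upwards [self_mem_nhdsWithin] with u hu
      linarith [(hX u hu).1]
  filter_upwards [hup, hlow] with u h1 h2
  rw [Real.dist_eq, abs_lt]
  constructor <;> linarith

end BestResponses

/-! ### Profit and welfare bounds for a single buyer type. -/

section SingleBuyer

variable {B S : Type*} {M : Market B S} {i : B}

/-- Subtracting a constant cost keeps log-concavity. -/
theorem rpow_sub_mul_rpow_sub_le {a b c v s : ℝ} (hc : 0 ≤ c) (hb : c < b) (ha : c < a)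
    (hs0 : 0 ≤ s) (hs1 : s ≤ 1) (hv : a ^ (1 - s) * b ^ s ≤ v) :
    (a - c) ^ (1 - s) * (b - c) ^ s ≤ v - c := by
  have ha0 : 0 < a := hc.trans_lt ha
  have hb0 : 0 < b := hc.trans_lt hb
  -- Superadditivity of the weighted geometric mean: AM-GM is applied to the ratios `(a - c) / a, (b
  -- - c) / b` and to `c / a, c / b`. The two arithmetic means add up to `1`.
  have h1 := Real.geom_mean_le_arith_mean2_weighted (sub_nonneg.2 hs1) hs0
    (div_nonneg (sub_pos.2 ha).le ha0.le) (div_nonneg (sub_pos.2 hb).le hb0.le) (by ring)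
  have h2 := Real.geom_mean_le_arith_mean2_weighted (sub_nonneg.2 hs1) hs0
    (div_nonneg hc ha0.le) (div_nonneg hc hb0.le) (by ring)
  have hA : 0 < a ^ (1 - s) := by positivity
  have hB : 0 < b ^ s := by positivity
  rw [Real.div_rpow (sub_pos.2 ha).le ha0.le, Real.div_rpow (sub_pos.2 hb).le hb0.le,
    div_mul_div_comm, div_le_iff₀ (by positivity)] at h1
  rw [Real.div_rpow hc ha0.le, Real.div_rpow hc hb0.le,
    div_mul_div_comm, div_le_iff₀ (by positivity)] at h2
  have h3 : c ^ (1 - s) * c ^ s = c := by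
    rw [← Real.rpow_add' hc (by simp)]; simp
  have h4 : (1 - s) * ((a - c) / a) + s * ((b - c) / b) + ((1 - s) * (c / a) + s * (c / b)) = 1 := by
    field_simp
    ring
  rw [h3] at h2
  have h5 : (a - c) ^ (1 - s) * (b - c) ^ s + c ≤ a ^ (1 - s) * b ^ s := by
    calc _ ≤ ((1 - s) * ((a - c) / a) + s * ((b - c) / b) + ((1 - s) * (c / a) + s * (c / b)))
          * (a ^ (1 - s) * b ^ s) := by rw [add_mul]; exact add_le_add h1 h2
      _ = _ := by rw [h4, one_mul]
  linarith

/-- The net value decays exponentially beyond the amount where it is `1 / e` of its peak. -/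
theorem IsInverseDemand.val_sub_le_exp (h : M.IsInverseDemand i) (hm : M.IsMHR i) {c x z : ℝ}
    (hc : 0 ≤ c) (hx : 0 < x) (hxz : x ≤ z) (hz : z ∈ M.dom i) (hc0 : c < M.val i 0)
    (hval : M.val i x - c = 1 / Real.exp 1 * (M.val i 0 - c)) :
    M.val i z - c ≤ (M.val i 0 - c) * Real.exp (-(z / x)) := by
  have hf0 : 0 < M.val i 0 - c := sub_pos.2 hc0
  rcases le_or_gt (M.val i z) c with hle | hgt
  · exact (sub_nonpos.2 hle).trans (by positivity)
  have hz0 : 0 < z := hx.trans_le hxz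
  have hs : 0 < x / z := by positivity
  have h1 := rpow_sub_mul_rpow_sub_le hc hgt hc0 hs.le ((div_le_one hz0).2 hxz)
    (h.rpow_mul_rpow_le hm hx.le hxz hz0 hz)
  have hfz : 0 < M.val i z - c := sub_pos.2 hgt
  -- Log-concavity of the margin `f` at `x` between `0` and `z` reads `(1 - x/z) log f(0) + (x/z)
  -- log f(z) ≤ log f(0) - 1`; solving for `log f(z)` gives the exponent `-z / x`.
  have h2 : Real.log ((M.val i 0 - c) ^ (1 - x / z) * (M.val i z - c) ^ (x / z)) ≤
      Real.log (1 / Real.exp 1 * (M.val i 0 - c)) := by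
    rw [← hval]
    exact Real.log_le_log (by positivity) h1
  rw [Real.log_mul (by positivity) (by positivity), Real.log_rpow hf0, Real.log_rpow hfz,
    Real.log_mul (by positivity) hf0.ne', one_div, Real.log_inv, Real.log_exp] at h2
  rw [← Real.log_le_log_iff hfz (by positivity), Real.log_mul hf0.ne' (by positivity),
    Real.log_exp]
  have h3 : x / z * (z / x) = 1 := by field_simp
  have h4 : x / z * Real.log (M.val i z - c) ≤ x / z * (Real.log (M.val i 0 - c) + -(z / x)) := by
    rw [mul_add, mul_neg, h3]
    linarith
  exact le_of_mul_le_mul_left h4 hs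

/-- The tail beyond `x` has total mass `x / e`. Multiplied by the peak margin this is exactly the
profit `(p - c) * x` at a margin of `1 / e` of the peak. -/
theorem integral_exp_neg_div_le {x b : ℝ} (hx : 0 < x) :
    ∫ z in x..b, Real.exp (-(z / x)) ≤ x * (1 / Real.exp 1) := by
  have hd : ∀ z ∈ uIcc x b, HasDerivAt (fun z => -x * Real.exp (-(z / x)))
      (Real.exp (-(z / x))) z := fun z _ => by
    have h1 : HasDerivAt (fun z : ℝ => -(z / x)) (-(1 / x)) z := ((hasDerivAt_id z).div_const x).neg
    refine (h1.exp.const_mul (-x)).congr_deriv ?_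
    field_simp
  rw [intervalIntegral.integral_eq_sub_of_hasDerivAt hd
    (Continuous.intervalIntegrable (by fun_prop) _ _), div_self hx.ne', Real.exp_neg 1]
  have : 0 ≤ x * Real.exp (-(b / x)) := by positivity
  rw [one_div]
  linarith

/-- A best response that does not exhaust the population has marginal value equal to the price. -/
theorem IsBestResponse.val_eq (h : M.IsInverseDemand i) {q a : ℝ} (ha : M.IsBestResponse i q a)
    (hpos : 0 < a) (hpop : (a : EReal) < M.pop i) : M.val i a = q :=
  (isBestResponse_iff M i h q a hpos hpop).1 ha

/-- The welfare lost on one buyer type by raising the price is at most the profit made from it. -/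
theorem IsBestResponse.integral_le (h : M.IsInverseDemand i) (hm : M.IsMHR i) {c p x x' : ℝ}
    (hc : 0 ≤ c) (hp : p < M.val i 0) (hpc : p - c = 1 / Real.exp 1 * (M.val i 0 - c))
    (hx : M.IsBestResponse i p x) (hxx : x ≤ x') (hx' : (x' : EReal) ≤ M.pop i) :
    ∫ z in x..x', M.val i z ≤ c * (x' - x) + (p - c) * x := by
  have hc0 : c < M.val i 0 := by
    have he : 1 < Real.exp 1 := Real.one_lt_exp_iff.2 one_pos
    have : 1 / Real.exp 1 < 1 := (div_lt_one (by positivity)).2 he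
    nlinarith
  have hx0 := hx.pos h hp
  -- If `x = x'`, the population may be exhausted and `λ(x) = p` may fail, but then no welfare is
  -- lost.
  rcases hxx.eq_or_lt with rfl | hlt
  · simp only [intervalIntegral.integral_same, sub_self, mul_zero, zero_add, hpc]
    have := sub_pos.2 hc0
    positivity
  have hval := hx.val_eq h hx0 (dom_of_lt hx0.le hlt hx').2
  have h1 := h.integral_le hx0.le hxx hx'
    (g := fun z => c + (M.val i 0 - c) * Real.exp (-(z / x))) (by fun_prop) fun z hxz hzx => by
      have := h.val_sub_le_exp hm hc hx0 hxz.le (dom_of_lt (hx0.le.trans hxz.le) hzx hx') hc0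
        (by rw [hval, hpc])
      linarith
  rw [intervalIntegral.integral_add (by simp) (Continuous.intervalIntegrable (by fun_prop) _ _),
    intervalIntegral.integral_const_mul, intervalIntegral.integral_const, smul_eq_mul] at h1
  have h2 := mul_le_mul_of_nonneg_left (integral_exp_neg_div_le (b := x') hx0) (sub_pos.2 hc0).le
  rw [hpc]
  linarith

/-- The profit from one buyer type at any other price is at most `e` times the profit at the price
where the margin is `1 / e` of its peak. -/
theorem IsBestResponse.margin_mul_le (h : M.IsInverseDemand i) (hm : M.IsMHR i)
    {c p x p' x' : ℝ} (hc : 0 ≤ c) (hp : p < M.val i 0)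
    (hpc : p - c = 1 / Real.exp 1 * (M.val i 0 - c)) (hx : M.IsBestResponse i p x)
    (hx' : M.IsBestResponse i p' x') : (p' - c) * x' ≤ Real.exp 1 * ((p - c) * x) := by
  have hc0 : c < M.val i 0 := by
    have he : 1 < Real.exp 1 := Real.one_lt_exp_iff.2 one_pos
    have : 1 / Real.exp 1 < 1 := (div_lt_one (by positivity)).2 he
    nlinarith
  have hx0 := hx.pos h hp
  have hf0 : 0 < M.val i 0 - c := sub_pos.2 hc0
  have heq : Real.exp 1 * ((p - c) * x) = (M.val i 0 - c) * x := by
    rw [hpc]; field_simp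
  rw [heq]
  -- The bound is proved for `z < x'` and passed to the limit, because `λ(x')` is uncontrolled when
  -- `x'` is the whole population. Up to `x` the peak margin suffices; beyond `x` the exponential
  -- decay is combined with `u ≤ exp u` for `u = z / x`.
  have key : ∀ z, 0 < z → z < x' → (p' - c) * z ≤ (M.val i 0 - c) * x := fun z hz hzx => by
    have hzd := dom_of_lt hz.le hzx hx'.2.1
    have h1 : p' - c ≤ M.val i z - c := sub_le_sub_right (hx'.2.2.1 z hz.le hzx) c
    rcases le_or_gt z x with hle | hgt
    · have h2 : p' - c ≤ M.val i 0 - c := h1.trans (sub_le_sub_right (h.val_le_zero hzd) c)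
      exact (mul_le_mul_of_nonneg_right h2 hz.le).trans (mul_le_mul_of_nonneg_left hle hf0.le)
    · have hval := hx.val_eq h hx0 (dom_of_le hx0.le hgt.le hzd.2).2
      have h2 := h.val_sub_le_exp hm hc hx0 hgt.le hzd hc0 (by rw [hval, hpc])
      have h3 : z / x ≤ Real.exp (z / x) := by linarith [Real.add_one_le_exp (z / x)]
      calc (p' - c) * z ≤ (M.val i 0 - c) * Real.exp (-(z / x)) * z :=
            mul_le_mul_of_nonneg_right (h1.trans h2) hz.le
        _ = (M.val i 0 - c) * x * (z / x * Real.exp (-(z / x))) := by field_simp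
        _ ≤ (M.val i 0 - c) * x * (Real.exp (z / x) * Real.exp (-(z / x))) := by gcongr
        _ = (M.val i 0 - c) * x := by rw [← Real.exp_add]; simp
  rcases hx'.1.eq_or_lt with h0 | h0
  · rw [← h0, mul_zero]; positivity
  have ht : Tendsto (fun z => (p' - c) * z) (𝓝[<] x') (𝓝 ((p' - c) * x')) :=
    ((continuous_const.mul continuous_id).tendsto x').mono_left nhdsWithin_le_nhds
  refine le_of_tendsto ht ?_
  filter_upwards [Ioo_mem_nhdsLT h0] with z hz using key z hz.1 hz.2

end SingleBuyer

end Market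

namespace Market

open Set Filter Topology MeasureTheory

/-! ### Min-cost flows and their marginal costs. -/

section Flow

variable {B S : Type*} {M : Market B S} {Bs : Set B} {Ss : Set S}
  {x x' : B → ℝ} {y z z' : B → S → ℝ} {i : B} {t : S}

theorem IsProductionCost.tendsto_marginal_add (h : M.IsProductionCost t) {L σ δ : ℝ} (hL : 0 ≤ L)
    (hδ : 0 < δ) (hpos : ∀ ε, 0 < ε → ε < δ → 0 ≤ L + σ * ε) :
    Tendsto (fun ε => M.marginal t (L + σ * ε)) (𝓝[>] 0) (𝓝 (M.marginal t L)) := by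
  have h1 : Tendsto (fun ε : ℝ => L + σ * ε) (𝓝[>] 0) (𝓝 L) := by
    have : Tendsto (fun ε : ℝ => L + σ * ε) (𝓝 0) (𝓝 (L + σ * 0)) :=
      Continuous.tendsto (by fun_prop) 0
    rw [mul_zero, add_zero] at this
    exact this.mono_left nhdsWithin_le_nhds
  refine (h.continuousOn_marginal L hL).tendsto.comp (tendsto_nhdsWithin_iff.2 ⟨h1, ?_⟩)
  filter_upwards [Ioo_mem_nhdsGT hδ] with ε hε using hpos ε hε.1 hε.2

section

variable [Fintype S]

theorem IsFlow.mem_of_pos (h : M.IsFlow Bs Ss x y) (hy : 0 < y i t) :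
    i ∈ Bs ∧ t ∈ Ss ∧ t ∈ M.desired i := h.support i t hy.ne'

theorem IsFlow.exists_pos (h : M.IsFlow Bs Ss x y) (hi : i ∈ Bs) (hx : 0 < x i) :
    ∃ t, 0 < y i t := by
  by_contra! hc
  have := h.total i hi
  linarith [Finset.sum_nonpos fun t (_ : t ∈ Finset.univ) => hc t]

theorem IsFlow.le_total (h : M.IsFlow Bs Ss x y) (hi : i ∈ Bs) (t : S) : y i t ≤ x i := by
  rw [← h.total i hi]
  exact Finset.single_le_sum (fun t _ => h.nonneg i t) (Finset.mem_univ t)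

theorem IsFlow.eq_zero (h : M.IsFlow Bs Ss x y) (ht : ¬ 0 < y i t) : y i t = 0 :=
  le_antisymm (not_lt.1 ht) (h.nonneg i t)

theorem IsFlow.add_single [DecidableEq B] (h : M.IsFlow Bs Ss x y) (hi : i ∈ Bs) {w : S → ℝ}
    (hw : ∀ t, 0 ≤ y i t + w t) (hs : ∀ t, w t ≠ 0 → t ∈ Ss ∧ t ∈ M.desired i) :
    M.IsFlow Bs Ss (Function.update x i (x i + ∑ t, w t)) (y + Pi.single i w) := by
  refine ⟨fun j t => ?_, fun j hj => ?_, fun j t hne => ?_⟩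
  · by_cases hji : j = i
    · subst hji; simpa using hw t
    · simpa [hji] using h.nonneg j t
  · by_cases hji : j = i
    · subst hji; simp [Finset.sum_add_distrib, h.total j hj]
    · simpa [hji] using h.total j hj
  · by_cases hji : j = i
    · subst hji
      by_cases hwt : w t = 0
      · exact h.support j t (by simpa [hwt] using hne)
      · exact ⟨hi, hs t hwt⟩
    · exact h.support j t (by simpa [hji] using hne)

theorem isCompact_setOf_isFlow (M : Market B S) (Bs : Set B) (Ss : Set S) (x : B → ℝ) :
    IsCompact {y | M.IsFlow Bs Ss x y} := by
  have hc : ∀ i t, Continuous fun y : B → S → ℝ => y i t := fun i t =>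
    (continuous_apply t).comp (continuous_apply i)
  have heq : {y | M.IsFlow Bs Ss x y} = {y | ∀ i t, 0 ≤ y i t} ∩
      {y | ∀ i ∈ Bs, ∑ t, y i t = x i} ∩
      {y | ∀ i t, y i t ≠ 0 → i ∈ Bs ∧ t ∈ Ss ∧ t ∈ M.desired i} := by
    ext y
    exact ⟨fun h => ⟨⟨h.1, h.2⟩, h.3⟩, fun h => ⟨h.1.1, h.1.2, h.2⟩⟩
  have hclosed : IsClosed {y | M.IsFlow Bs Ss x y} := by
    rw [heq]
    simp only [ofPred_forall]
    refine ((isClosed_iInter fun i => isClosed_iInter fun t => ?_).inter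
      (isClosed_iInter fun i => isClosed_iInter fun _ => ?_)).inter
      (isClosed_iInter fun i => isClosed_iInter fun t => ?_)
    · exact isClosed_le continuous_const (hc i t)
    · exact isClosed_eq (continuous_finsetSum _ fun t _ => hc i t) continuous_const
    · by_cases hP : i ∈ Bs ∧ t ∈ Ss ∧ t ∈ M.desired i
      · simp [hP]
      · simpa [hP] using isClosed_eq (hc i t) continuous_const
  refine IsCompact.of_isClosed_subset (isCompact_Icc (a := 0) (b := fun i _ => |x i|)) hclosed ?_
  intro y hy
  refine ⟨fun i t => hy.nonneg i t, fun i t => ?_⟩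
  by_cases hi : i ∈ Bs
  · exact (hy.le_total hi t).trans (le_abs_self _)
  · by_contra! hlt
    exact hi (hy.mem_of_pos ((abs_nonneg _).trans_lt hlt)).1

end

section

variable [Fintype B]

theorem continuous_load (t : S) : Continuous fun y : B → S → ℝ => load y t :=
  continuous_finsetSum _ fun i _ => (continuous_apply t).comp (continuous_apply i)

theorem load_add_single [DecidableEq B] (y : B → S → ℝ) (i : B) (w : S → ℝ) (t : S) :
    load (y + Pi.single i w) t = load y t + w t := by
  have : ∀ j, (Pi.single i w : B → S → ℝ) j t = if j = i then w t else 0 := fun j => by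
    by_cases h : j = i
    · subst h; simp
    · simp [h]
  simp [load, Finset.sum_add_distrib, this]

end

variable [Fintype B] [Fintype S]

theorem IsFlow.load_nonneg (h : M.IsFlow Bs Ss x y) (t : S) : 0 ≤ load y t :=
  Finset.sum_nonneg fun i _ => h.nonneg i t

theorem exists_isMinCostFlow (hcost : ∀ t, M.IsProductionCost t)
    (hx : ∀ i ∈ Bs, 0 ≤ x i ∧ ∃ t ∈ Ss, t ∈ M.desired i) :
    ∃ y, M.IsMinCostFlow Bs Ss x y := by
  classical
  have hg' : ∀ i, ∃ t, i ∈ Bs → t ∈ Ss ∧ t ∈ M.desired i := fun i => by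
    by_cases hi : i ∈ Bs
    · exact (hx i hi).2.imp fun t ht _ => ht
    · exact ⟨(M.desired_nonempty i).choose, fun h => absurd h hi⟩
  choose g hg using hg'
  have hne : {y | M.IsFlow Bs Ss x y}.Nonempty := by
    refine ⟨fun i t => if i ∈ Bs ∧ t = g i then x i else 0, fun i t => ?_, fun i hi => ?_,
      fun i t h => ?_⟩
    · split_ifs with h
      exacts [(hx i h.1).1, le_rfl]
    · simp [hi]
    · have h' : i ∈ Bs ∧ t = g i := by
        by_contra hc
        exact h (if_neg hc)
      rw [h'.2]
      exact ⟨h'.1, hg i h'.1⟩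
  have hcont : ContinuousOn M.totalCost {y | M.IsFlow Bs Ss x y} :=
    continuousOn_finsetSum _ fun t _ => (hcost t).continuousOn_cost.comp
      (continuous_load t).continuousOn fun y hy => hy.load_nonneg t
  obtain ⟨y, hy, hmin⟩ := (isCompact_setOf_isFlow M Bs Ss x).exists_isMinOn hne hcont
  exact ⟨y, hy, fun z hz => hmin hz⟩

section Perturbation

variable [DecidableEq B]

/-- The tangents are taken at the perturbed loads, since convexity then bounds the new cost from
above. Continuity of the marginals restores the old loads in the limit. -/
theorem totalCost_add_single_le (hcost : ∀ t, M.IsProductionCost t) (hy : ∀ t, 0 ≤ load y t)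
    {w : S → ℝ} (hw : ∀ t, 0 ≤ load y t + w t) :
    M.totalCost (y + Pi.single i w) ≤
      M.totalCost y + ∑ t, M.marginal t (load y t + w t) * w t := by
  rw [totalCost, totalCost, ← Finset.sum_add_distrib]
  refine Finset.sum_le_sum fun t _ => ?_
  rw [load_add_single]
  have := (hcost t).tangent_le (hw t) (hy t)
  linarith

end Perturbation

theorem IsFlow.apply_le_load (h : M.IsFlow Bs Ss x y) (i : B) (t : S) : y i t ≤ load y t :=
  Finset.single_le_sum (f := fun i => y i t) (fun i _ => h.nonneg i t) (Finset.mem_univ i)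

/-- Every buyer type is served by the reachable goods of smallest marginal cost. -/
def IsEquilibrated (M : Market B S) (Bs : Set B) (Ss : Set S) (y : B → S → ℝ) : Prop :=
  ∀ i ∈ Bs, ∀ t t', 0 < y i t → t' ∈ Ss → t' ∈ M.desired i →
    M.marginal t (load y t) ≤ M.marginal t' (load y t')

/-- Rerouting a small amount `ε` of type `i` from `t` to `t'` must not lower the cost; divide by `ε`
and let `ε → 0`. -/
theorem IsMinCostFlow.isEquilibrated (hcost : ∀ t, M.IsProductionCost t)
    (h : M.IsMinCostFlow Bs Ss x y) : M.IsEquilibrated Bs Ss y := by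
  classical
  intro i hi t t' hpos ht' hd'
  rcases eq_or_ne t t' with rfl | hne
  · rfl
  obtain ⟨-, ht, hd⟩ := h.1.mem_of_pos hpos
  have hle := h.1.apply_le_load i t
  have key : ∀ ε, 0 < ε → ε < y i t →
      M.marginal t (load y t + -1 * ε) ≤ M.marginal t' (load y t' + 1 * ε) := fun ε h0 h1 => by
    set w : S → ℝ := Pi.single t' ε - Pi.single t ε with hw
    have hwt : w t = -ε := by simp [hw, hne]
    have hwt' : w t' = ε := by simp [hw, hne.symm]
    have hwo : ∀ s, s ≠ t → s ≠ t' → w s = 0 := fun s hs hs' => by simp [hw, hs, hs']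
    have hnn : ∀ u : S → ℝ, 0 ≤ u → y i t ≤ u t → ∀ s, 0 ≤ u s + w s := fun u hu hut s => by
      by_cases hs : s = t
      · subst hs; linarith
      by_cases hs' : s = t'
      · subst hs'; linarith [hu s, show (0 : S → ℝ) s = 0 from rfl]
      · rw [hwo s hs hs', add_zero]; exact hu s
    have hsum : ∀ m : S → ℝ, ∑ s, m s * w s = m t' * ε - m t * ε := fun m => by
      simp [hw, mul_sub, Pi.single_apply]
    have hf := h.1.add_single hi (w := w) (hnn _ (h.1.nonneg i) le_rfl) fun s hs => by
      by_cases hst : s = t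
      · rw [hst]; exact ⟨ht, hd⟩
      by_cases hst' : s = t'
      · rw [hst']; exact ⟨ht', hd'⟩
      · exact absurd (hwo s hst hst') hs
    have hw0 : ∑ s, w s = 0 := by simpa using hsum 1
    rw [hw0, add_zero, Function.update_eq_self] at hf
    have h2 := (h.2 _ hf).trans
      (totalCost_add_single_le hcost h.1.load_nonneg (hnn _ h.1.load_nonneg hle))
    rw [hsum fun s => M.marginal s (load y s + w s), hwt, hwt'] at h2
    rw [neg_one_mul, one_mul]
    exact le_of_mul_le_mul_right (by linarith) h0
  refine le_of_tendsto_of_tendsto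
    ((hcost t).tendsto_marginal_add (σ := -1) (h.1.load_nonneg t) hpos fun ε _ h1 => by linarith)
    ((hcost t').tendsto_marginal_add (σ := 1) (h.1.load_nonneg t') hpos fun ε h0 _ => by
      linarith [h.1.load_nonneg t']) ?_
  filter_upwards [Ioo_mem_nhdsGT hpos] with ε hε using key ε hε.1 hε.2

/-- Comparison of equilibrated flows in the same graph: where the marginal cost of a good increases,
its load increases by no more than the total increase of the demands. -/
theorem IsEquilibrated.load_le_or_marginal_le (hcost : ∀ t, M.IsProductionCost t)
    (hz : M.IsFlow Bs Ss x z) (hz' : M.IsFlow Bs Ss x' z') (he : M.IsEquilibrated Bs Ss z)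
    (he' : M.IsEquilibrated Bs Ss z') (ht : t ∈ Ss) :
    load z' t ≤ load z t + ∑ i, max (x' i - x i) 0 ∨
      M.marginal t (load z' t) ≤ M.marginal t (load z t) := by
  classical
  by_contra! hc
  obtain ⟨hc1, hc2⟩ := hc
  set c : S → ℝ := fun s => M.marginal s (load z s) with hcdef
  set c' : S → ℝ := fun s => M.marginal s (load z' s) with hcdef'
  -- With the threshold `c' t`, the set `A` consists of the goods whose marginal cost passed from
  -- below the threshold to at least the threshold. By monotonicity of marginals, no load in `A`
  -- decreased.
  set A : Finset S := {s | s ∈ Ss ∧ c' t ≤ c' s ∧ c s < c' t} with hA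
  have htA : t ∈ A := by simp [hA, ht]; exact hc2
  have hlt : ∀ s ∈ A, load z s ≤ load z' s := fun s hs => by
    simp only [hA, Finset.mem_filter, Finset.mem_univ, true_and] at hs
    by_contra! hlt
    have := (hcost s).marginal_mono (hz'.load_nonneg s) hlt.le
    exact absurd (hs.2.1.trans (this.trans_lt hs.2.2).le) (by linarith [hs.2.1, hs.2.2])
  have hbuyer : ∀ i, ∑ s ∈ A, z' i s ≤ ∑ s ∈ A, z i s + max (x' i - x i) 0 := fun i => by
    have h0 : 0 ≤ max (x' i - x i) 0 := le_max_right _ _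
    by_cases hex : ∃ s ∈ A, 0 < z' i s
    · obtain ⟨s, hs, hpos⟩ := hex
      obtain ⟨hi, -, hsd⟩ := hz'.mem_of_pos hpos
      have hs' := hs
      simp only [hA, Finset.mem_filter, Finset.mem_univ, true_and] at hs'
      -- A type using some `s ∈ A` in the new flow had its whole old flow inside `A`: a good `r` it
      -- used before was no dearer than `s` at the margin then, and is no cheaper than `s` at the
      -- margin now. Its flow into `A` thus grows by at most its demand increase.
      have hsub : ∑ r ∈ A, z i r = x i := by
        rw [← hz.total i hi]
        refine Finset.sum_subset (Finset.subset_univ A) fun r _ hr => ?_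
        refine hz.eq_zero fun hrpos => hr ?_
        obtain ⟨-, hrS, hrd⟩ := hz.mem_of_pos hrpos
        simp only [hA, Finset.mem_filter, Finset.mem_univ, true_and]
        exact ⟨hrS, hs'.2.1.trans (he' i hi s r hpos hrS hrd),
          (he i hi r s hrpos hs'.1 hsd).trans_lt hs'.2.2⟩
      have hsub' : ∑ r ∈ A, z' i r ≤ x' i := by
        rw [← hz'.total i hi]
        exact Finset.sum_le_sum_of_subset_of_nonneg (Finset.subset_univ A)
          fun r _ _ => hz'.nonneg i r
      linarith [le_max_left (x' i - x i) 0]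
    · push Not at hex
      have h1 : ∑ s ∈ A, z' i s ≤ 0 := Finset.sum_nonpos hex
      have h2 : 0 ≤ ∑ s ∈ A, z i s := Finset.sum_nonneg fun s _ => hz.nonneg i s
      linarith
  have htot : ∑ s ∈ A, load z' s ≤ ∑ s ∈ A, load z s + ∑ i, max (x' i - x i) 0 := by
    simp only [load]
    rw [Finset.sum_comm, Finset.sum_comm (s := A), ← Finset.sum_add_distrib]
    exact Finset.sum_le_sum fun i _ => hbuyer i
  -- Since all loads in `A` grow, the growth at `t` alone is at most the total growth, which is
  -- bounded by the demand increase.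
  have h1 : load z' t - load z t ≤ ∑ s ∈ A, (load z' s - load z s) :=
    Finset.single_le_sum (f := fun s => load z' s - load z s)
      (fun s hs => sub_nonneg.2 (hlt s hs)) htA
  rw [Finset.sum_sub_distrib] at h1
  linarith

end Flow

/-! ### First-order conditions at a welfare optimum. -/

section Optimum

variable {B S : Type*} [Fintype B] [Fintype S] {M : Market B S} {x : B → ℝ} {y : B → S → ℝ} {i : B}

theorem IsWelfareOptimal.isMinCostFlow (h : M.IsWelfareOptimal x y) :
    M.IsMinCostFlow univ univ x y :=
  ⟨h.1.2, fun z hz => by have := h.2 x z ⟨h.1.1, hz⟩; simp only [welfare] at this; linarith⟩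

theorem IsWelfareOptimal.integral_sub_le [DecidableEq B] (hcost : ∀ t, M.IsProductionCost t)
    (h : M.IsWelfareOptimal x y) {w : S → ℝ} (hw : ∀ t, 0 ≤ y i t + w t)
    (hs : ∀ t, w t ≠ 0 → t ∈ M.desired i) (hx : ((x i + ∑ t, w t : ℝ) : EReal) ≤ M.pop i) :
    (∫ z in (0 : ℝ)..(x i + ∑ t, w t), M.val i z) - ∫ z in (0 : ℝ)..(x i), M.val i z ≤
      ∑ t, M.marginal t (load y t + w t) * w t := by
  have hf := h.1.2.add_single (mem_univ i) hw fun t ht => ⟨mem_univ t, hs t ht⟩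
  have h0 : 0 ≤ x i + ∑ t, w t := by
    rw [← h.1.2.total i (mem_univ i), ← Finset.sum_add_distrib]
    exact Finset.sum_nonneg fun t _ => hw t
  have hwel := h.2 _ _ ⟨fun j => by
    by_cases hj : j = i
    · subst hj; simpa using ⟨h0, hx⟩
    · simpa [hj] using h.1.1 j, hf⟩
  have hsum : ∑ j, ((∫ z in (0 : ℝ)..(Function.update x i (x i + ∑ t, w t) j), M.val j z) -
      ∫ z in (0 : ℝ)..(x j), M.val j z) =
      (∫ z in (0 : ℝ)..(x i + ∑ t, w t), M.val i z) - ∫ z in (0 : ℝ)..(x i), M.val i z := by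
    rw [Finset.sum_eq_single i (fun j _ hj => by simp [hj]) (by simp)]
    simp
  rw [Finset.sum_sub_distrib] at hsum
  have hc := totalCost_add_single_le (i := i) hcost h.1.2.load_nonneg (w := w) fun t => by
    linarith [h.1.2.apply_le_load i t, hw t]
  simp only [welfare] at hwel
  linarith

/-- A welfare optimum with prices equal to marginal costs is envy-free. -/
theorem IsWelfareOptimal.isEnvyFree (hdemand : ∀ i, M.IsInverseDemand i)
    (hcost : ∀ t, M.IsProductionCost t) (h : M.IsWelfareOptimal x y) :
    M.IsEnvyFree (M.initialPrice y) x y := by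
  classical
  have hmin : ∀ i t, 0 < y i t → M.initialPrice y t = M.minPrice (M.initialPrice y) i :=
    fun i t hpos => le_antisymm
      (Finset.le_inf' _ _ fun t' ht' =>
        h.isMinCostFlow.isEquilibrated hcost i (mem_univ i) t t' hpos (mem_univ _) ht')
      (Finset.inf'_le _ (h.1.2.mem_of_pos hpos).2.2)
  refine ⟨fun i => ⟨(h.1.1 i).1, (h.1.1 i).2, fun z hz hzx => ?_, fun z hxz hzp => ?_⟩, h.1.2, hmin⟩
  -- Lower the demand of `i` by `ε` at a good it uses: the welfare lost is at most `λ(z) * ε`, the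
  -- cost saved about the marginal cost times `ε`.
  · obtain ⟨t, ht⟩ := h.1.2.exists_pos (mem_univ i) (hz.trans_lt hzx)
    rw [← hmin i t ht]
    have hδ : 0 < min (y i t) (x i - z) := lt_min ht (sub_pos.2 hzx)
    have hle := h.1.2.apply_le_load i t
    refine le_of_tendsto ((hcost t).tendsto_marginal_add (σ := -1) (h.1.2.load_nonneg t) hδ
      fun ε _ h1 => by linarith [min_le_left (y i t) (x i - z)]) ?_
    filter_upwards [Ioo_mem_nhdsGT hδ] with ε hε
    have h1 : ε < y i t := hε.2.trans_le (min_le_left _ _)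
    have h2 : ε < x i - z := hε.2.trans_le (min_le_right _ _)
    have hsum : ∑ s, (Pi.single t (-ε) : S → ℝ) s = -ε := by simp
    have hxe : x i + -ε ≤ x i := by linarith [hε.1]
    have h3 := h.integral_sub_le (i := i) hcost (w := Pi.single t (-ε)) (fun s => by
        by_cases hs : s = t
        · subst hs; simp only [Pi.single_eq_same]; linarith
        · simpa [hs] using h.1.2.nonneg i s) (fun s hs => by
        by_cases hst : s = t
        · rw [hst]; exact (h.1.2.mem_of_pos ht).2.2
        · simp [hst] at hs) (by
        rw [hsum]; exact (EReal.coe_le_coe_iff.2 hxe).trans (h.1.1 i).2)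
    rw [hsum, Finset.sum_eq_single t (fun s _ hs => by simp [hs]) (by simp),
      Pi.single_eq_same] at h3
    have h4 := (hdemand i).integral_sub_integral (by linarith : 0 ≤ x i + -ε) hxe (h.1.1 i).2
    have h5 := (hdemand i).integral_le_mul (m := M.val i z) (by linarith : 0 ≤ x i + -ε) hxe
      (h.1.1 i).2 fun u hu hux => (hdemand i).antitone (dom_of_lt hz hzx (h.1.1 i).2)
        (dom_of_lt (by linarith) hux (h.1.1 i).2) (by linarith)
    rw [neg_one_mul]
    exact le_of_mul_le_mul_right (by linarith) hε.1
  -- Conversely, serve `ε` more buyers of type `i` with a cheapest desired good; the welfare gained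
  -- is at least `λ(z) * ε`.
  · obtain ⟨t, htd, hteq⟩ := Finset.exists_mem_eq_inf' (M.desired_nonempty i) (M.initialPrice y)
    rw [minPrice, hteq]
    have hδ : 0 < z - x i := sub_pos.2 hxz
    have hx0 := (h.1.1 i).1
    refine ge_of_tendsto ((hcost t).tendsto_marginal_add (σ := 1) (h.1.2.load_nonneg t) hδ
      fun ε h0 _ => by linarith [h.1.2.load_nonneg t]) ?_
    filter_upwards [Ioo_mem_nhdsGT hδ] with ε hε
    have hsum : ∑ s, (Pi.single t ε : S → ℝ) s = ε := by simp
    have hxe : x i ≤ x i + ε := by linarith [hε.1]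
    have hxez : x i + ε ≤ z := by linarith [hε.2]
    have hpop : ((x i + ε : ℝ) : EReal) ≤ M.pop i := (EReal.coe_le_coe_iff.2 hxez).trans hzp.le
    have h3 := h.integral_sub_le (i := i) hcost (w := Pi.single t ε) (fun s => by
        by_cases hs : s = t
        · subst hs; simp only [Pi.single_eq_same]; linarith [h.1.2.nonneg i s, hε.1]
        · simpa [hs] using h.1.2.nonneg i s) (fun s hs => by
        by_cases hst : s = t
        · rw [hst]; exact htd
        · simp [hst] at hs) (by rw [hsum]; exact hpop)
    rw [hsum, Finset.sum_eq_single t (fun s _ hs => by simp [hs]) (by simp),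
      Pi.single_eq_same] at h3
    have h4 := (hdemand i).integral_sub_integral hx0 hxe hpop
    have h5 := (hdemand i).le_integral (m := M.val i z) hx0 hxe hpop
      fun u hu hux => (hdemand i).antitone (dom_of_le (by linarith) (by linarith) hzp)
        ⟨by linarith, hzp⟩ (by linarith)
    rw [one_mul]
    exact le_of_mul_le_mul_right (by linarith) hε.1

end Optimum

end Market

namespace Market

open Set Filter Topology MeasureTheory

/-! ### The stopping rule and the invariant of the procedure. -/

section StopRule

variable {k lam q c c' : ℝ}

/-- The criterion reads `q ≥ lam / k + (1 - 1 / k) * c`, whose right-hand side increases with `c`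
because `k > 1`. -/
theorem Stops.mono (hk : 1 < k) (h : Stops k lam q c) (hc : c' ≤ c) : Stops k lam q c' := by
  have hk' : 1 / k < 1 := (div_lt_one (one_pos.trans hk)).2 hk
  unfold Stops at *
  nlinarith

theorem stops_self_iff (hk : 1 < k) : Stops k lam q q ↔ lam ≤ q := by
  have hk' : 0 < 1 / k := by positivity
  unfold Stops
  constructor <;> intro h <;> nlinarith

theorem lt_peak_of_not_stops (hk : 1 < k) (h : ¬ Stops k lam q c) (hc : c ≤ q) : q < lam := by
  by_contra! hle
  exact h (((stops_self_iff hk).2 hle).mono hk hc)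

theorem lt_peak_of_margin_eq (hk : 1 < k) (h : q - c = 1 / k * (lam - c)) (hq : q < lam) :
    c < lam := by
  have hk' : 1 / k < 1 := (div_lt_one (one_pos.trans hk)).2 hk
  nlinarith

end StopRule

variable {B S : Type*} [Fintype B] [Fintype S] {M : Market B S} {k lam : ℝ} {xs : B → ℝ}
  {ys : B → S → ℝ} {s s' : State B S}

/-- The standing assumptions: a market with uniform peak `lam`, a stop parameter `k > 1`, and an
allocation `(xs, ys)` that is envy-free when all goods are priced at marginal cost. -/
structure IsAdmissible (M : Market B S) (k lam : ℝ) (xs : B → ℝ) (ys : B → S → ℝ) : Prop where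
  demand : ∀ i, M.IsInverseDemand i
  mhr : ∀ i, M.IsMHR i
  peak : ∀ i, M.val i 0 = lam
  cost : ∀ t, M.IsProductionCost t
  one_lt : 1 < k
  envyFree : M.IsEnvyFree (M.initialPrice ys) xs ys

theorem IsAdmissible.initialPrice_le (h : M.IsAdmissible k lam xs ys) {i : B} {t t' : S}
    (ht : 0 < ys i t) (ht' : t' ∈ M.desired i) : M.initialPrice ys t ≤ M.initialPrice ys t' := by
  rw [h.envyFree.cheapest i t ht]
  exact Finset.inf'_le _ ht'

theorem IsAdmissible.bestResponse (h : M.IsAdmissible k lam xs ys) {i : B} {t : S}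
    (ht : 0 < ys i t) : M.IsBestResponse i (M.initialPrice ys t) (xs i) := by
  rw [h.envyFree.cheapest i t ht]
  exact h.envyFree.bestResponse i

/-- The invariant of the ascending-price procedure. -/
structure State.IsConsistent (M : Market B S) (k lam : ℝ) (xs : B → ℝ) (ys : B → S → ℝ)
    (s : State B S) : Prop where
  flow : M.IsFlow univ univ s.x s.y
  item_inactive : ∀ t, s.item t = Phase.inactive →
    s.price t = M.initialPrice ys t ∧ s.level < M.initialPrice ys t ∧
      M.marginal t (load s.y t) = M.initialPrice ys t
  item_active : ∀ t, s.item t = Phase.active →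
    s.price t = s.level ∧ M.initialPrice ys t ≤ s.level ∧ M.marginal t (load s.y t) ≤ s.level ∧
      ¬ Stops k lam s.level (M.marginal t (load s.y t))
  item_finished : ∀ t, s.item t = Phase.finished →
    M.initialPrice ys t ≤ s.price t ∧ s.price t ≤ s.level ∧
      ((lam ≤ s.price t ∧ M.marginal t (load s.y t) = s.price t) ∨
        (s.price t < lam ∧ s.price t - M.marginal t (load s.y t) =
          1 / k * (lam - M.marginal t (load s.y t))))
  buyer_inactive : ∀ i, s.buyer i = Phase.inactive →
    s.x i = xs i ∧ s.y i = ys i ∧ ∀ t, 0 < s.y i t → s.item t = Phase.inactive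
  buyer_active : ∀ i, s.buyer i = Phase.active →
    0 < s.x i ∧ s.x i ≤ xs i ∧ s.level < lam ∧ M.IsBestResponse i s.level (s.x i) ∧
      (∀ t, 0 < s.y i t → s.item t = Phase.active) ∧
      ∀ t ∈ M.desired i, s.item t ≠ Phase.finished
  equilibrated : M.IsEquilibrated {i | s.buyer i = Phase.active} {t | s.item t = Phase.active} s.y
  buyer_finished : ∀ i, s.buyer i = Phase.finished →
    ∃ q, M.IsBestResponse i q (s.x i) ∧ s.x i ≤ xs i ∧ (lam ≤ q → s.x i = xs i) ∧
      (∀ t, 0 < s.y i t → s.item t = Phase.finished ∧ s.price t = q) ∧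
      (∀ t ∈ M.desired i, s.item t = Phase.finished → q ≤ s.price t) ∧
      ∃ t ∈ M.desired i, s.item t = Phase.finished ∧ s.price t = q

/-- `(x, y)` serves the active buyers of `s` through active goods of least marginal cost and keeps
the allocation of all others. -/
structure State.IsServed (M : Market B S) (s : State B S) (x : B → ℝ) (y : B → S → ℝ) : Prop where
  flow : M.IsFlow univ univ x y
  active : ∀ i, s.buyer i = Phase.active → ∀ t, 0 < y i t → s.item t = Phase.active
  frozen : ∀ i, s.buyer i ≠ Phase.active → x i = s.x i ∧ y i = s.y i
  equilibrated : M.IsEquilibrated {i | s.buyer i = Phase.active} {t | s.item t = Phase.active} y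

theorem State.IsConsistent.isServed (h : s.IsConsistent M k lam xs ys) :
    s.IsServed M s.x s.y :=
  ⟨h.flow, fun i hi => (h.buyer_active i hi).2.2.2.2.1, fun _ _ => ⟨rfl, rfl⟩, h.equilibrated⟩

/-- Together with `eq_zero_of_item_ne` this decouples the active subgraph from the rest: loads of
active goods come from active buyers only, and repricing leaves all other loads unchanged. -/
theorem State.IsConsistent.eq_zero_of_buyer_ne (h : s.IsConsistent M k lam xs ys) {i : B} {t : S}
    (hi : s.buyer i ≠ Phase.active) (ht : s.item t = Phase.active) : s.y i t = 0 := by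
  refine h.flow.eq_zero fun hpos => ?_
  cases hb : s.buyer i with
  | inactive => simp [(h.buyer_inactive i hb).2.2 t hpos] at ht
  | active => exact hi hb
  | finished =>
    obtain ⟨q, -, -, -, hq, -⟩ := h.buyer_finished i hb
    simp [(hq t hpos).1] at ht

theorem State.IsConsistent.eq_zero_of_item_ne (h : s.IsConsistent M k lam xs ys) {i : B} {t : S}
    (hi : s.buyer i = Phase.active) (ht : s.item t ≠ Phase.active) : s.y i t = 0 :=
  h.flow.eq_zero fun hpos => ht ((h.buyer_active i hi).2.2.2.2.1 t hpos)

open Classical in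
/-- The part of a flow that serves the active buyers. -/
noncomputable def State.activePart (s : State B S) (y : B → S → ℝ) (i : B) (t : S) : ℝ :=
  if s.buyer i = Phase.active then y i t else 0

theorem State.IsServed.load_activePart (h : s.IsConsistent M k lam xs ys) {x : B → ℝ}
    {y : B → S → ℝ} (hy : s.IsServed M x y) {t : S} (ht : s.item t = Phase.active) :
    load (s.activePart y) t = load y t := by
  refine Finset.sum_congr rfl fun i _ => ?_
  unfold State.activePart
  split_ifs with hi
  · rfl
  · rw [(hy.frozen i hi).2, h.eq_zero_of_buyer_ne hi ht]

theorem State.IsServed.load_eq (h : s.IsConsistent M k lam xs ys) {x : B → ℝ}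
    {y : B → S → ℝ} (hy : s.IsServed M x y) {t : S} (ht : s.item t ≠ Phase.active) :
    load y t = load s.y t := by
  refine Finset.sum_congr rfl fun i _ => ?_
  by_cases hi : s.buyer i = Phase.active
  · rw [h.eq_zero_of_item_ne hi ht, hy.flow.eq_zero fun hpos => ht (hy.active i hi t hpos)]
  · rw [(hy.frozen i hi).2]

theorem State.IsServed.isFlow_activePart {x : B → ℝ} {y : B → S → ℝ} (hy : s.IsServed M x y) :
    M.IsFlow {i | s.buyer i = Phase.active} {t | s.item t = Phase.active} x (s.activePart y) := by
  refine ⟨fun i t => ?_, fun i hi => ?_, fun i t hne => ?_⟩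
  · unfold State.activePart
    split_ifs
    exacts [hy.flow.nonneg i t, le_rfl]
  · have hi' : s.buyer i = Phase.active := hi
    simpa [State.activePart, hi'] using hy.flow.total i (mem_univ i)
  · by_cases hi : s.buyer i = Phase.active
    · simp only [State.activePart, hi, if_true] at hne
      have hpos : 0 < y i t := lt_of_le_of_ne (hy.flow.nonneg i t) hne.symm
      exact ⟨hi, hy.active i hi t hpos, (hy.flow.mem_of_pos hpos).2.2⟩
    · simp [State.activePart, hi] at hne

theorem State.IsServed.isEquilibrated_activePart (h : s.IsConsistent M k lam xs ys) {x : B → ℝ}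
    {y : B → S → ℝ} (hy : s.IsServed M x y) :
    M.IsEquilibrated {i | s.buyer i = Phase.active} {t | s.item t = Phase.active}
      (s.activePart y) := by
  intro i hi t t' hpos ht' hd'
  have hi' : s.buyer i = Phase.active := hi
  have hpos' : 0 < y i t := by simpa [State.activePart, hi'] using hpos
  rw [hy.load_activePart h (hy.active i hi t hpos'), hy.load_activePart h ht']
  exact hy.equilibrated i hi t t' hpos' ht' hd'

theorem State.IsServed.load_le_or_marginal_le (hM : M.IsAdmissible k lam xs ys)
    (h : s.IsConsistent M k lam xs ys) {x x' : B → ℝ} {y y' : B → S → ℝ}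
    (hy : s.IsServed M x y) (hy' : s.IsServed M x' y') {t : S} (ht : s.item t = Phase.active) :
    load y' t ≤ load y t + ∑ i, max (x' i - x i) 0 ∨
      M.marginal t (load y' t) ≤ M.marginal t (load y t) := by
  rw [← hy.load_activePart h ht, ← hy'.load_activePart h ht]
  exact IsEquilibrated.load_le_or_marginal_le hM.cost hy.isFlow_activePart hy'.isFlow_activePart
    (hy.isEquilibrated_activePart h) (hy'.isEquilibrated_activePart h) ht

theorem State.IsServed.marginal_le (hM : M.IsAdmissible k lam xs ys)
    (h : s.IsConsistent M k lam xs ys) {x x' : B → ℝ} {y y' : B → S → ℝ}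
    (hy : s.IsServed M x y) (hy' : s.IsServed M x' y') (hx : ∀ i, x' i ≤ x i) {t : S}
    (ht : s.item t = Phase.active) :
    M.marginal t (load y' t) ≤ M.marginal t (load y t) := by
  rcases hy.load_le_or_marginal_le hM h hy' ht with hl | hl
  · rw [Finset.sum_eq_zero fun i _ => max_eq_right (sub_nonpos.2 (hx i)), add_zero] at hl
    exact (hM.cost t).marginal_mono (hy'.flow.load_nonneg t) hl
  · exact hl

theorem IsRepriced.isServed (hM : M.IsAdmissible k lam xs ys)
    (h : s.IsConsistent M k lam xs ys) {r : ℝ} {x : B → ℝ} {y : B → S → ℝ}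
    (hy : M.IsRepriced s r x y) : s.IsServed M x y := by
  obtain ⟨z, hz, hyz⟩ := hy.minCost
  -- Frozen buyers use no active good, so active goods have the same load in `y` as in the min-cost
  -- flow `z` of the active subgraph.
  have hload : ∀ t, s.item t = Phase.active → load y t = load z t := fun t ht => by
    refine Finset.sum_congr rfl fun i _ => ?_
    by_cases hi : s.buyer i = Phase.active
    · rw [hyz i hi]
    · rw [(hy.frozen i hi).2, h.eq_zero_of_buyer_ne hi ht,
        hz.1.eq_zero fun hpos => hi (hz.1.mem_of_pos hpos).1]
  have hact : ∀ i, s.buyer i = Phase.active → ∀ t, 0 < y i t → s.item t = Phase.active :=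
    fun i hi t hpos => by
      rw [hyz i hi] at hpos
      exact (hz.1.mem_of_pos hpos).2.1
  refine ⟨⟨fun i t => ?_, fun i _ => ?_, fun i t hne => ⟨mem_univ _, mem_univ _, ?_⟩⟩, hact,
    hy.frozen, fun i hi t t' hpos ht' hd' => ?_⟩
  · by_cases hi : s.buyer i = Phase.active
    · rw [hyz i hi]; exact hz.1.nonneg i t
    · rw [(hy.frozen i hi).2]; exact h.flow.nonneg i t
  · by_cases hi : s.buyer i = Phase.active
    · rw [hyz i hi]; exact hz.1.total i hi
    · rw [(hy.frozen i hi).2, (hy.frozen i hi).1]; exact h.flow.total i (mem_univ i)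
  · by_cases hi : s.buyer i = Phase.active
    · rw [hyz i hi] at hne; exact (hz.1.support i t hne).2.2
    · rw [(hy.frozen i hi).2] at hne; exact (h.flow.support i t hne).2.2
  · rw [hload t (hact i hi t hpos), hload t' ht']
    rw [hyz i hi] at hpos
    exact hz.isEquilibrated hM.cost i hi t t' hpos ht' hd'

/-- The procedure can reprice at every higher price up to the peak. -/
theorem State.IsConsistent.exists_isRepriced (hM : M.IsAdmissible k lam xs ys)
    (h : s.IsConsistent M k lam xs ys) {r : ℝ} (hr : s.level ≤ r)
    (hlam : r ≤ lam ∨ ∀ i, s.buyer i ≠ Phase.active) : ∃ x y, M.IsRepriced s r x y := by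
  classical
  have hx : ∀ i, ∃ a, (s.buyer i = Phase.active → M.IsBestResponse i r a) ∧
      (s.buyer i ≠ Phase.active → a = s.x i) := fun i => by
    by_cases hi : s.buyer i = Phase.active
    · have hle : r ≤ M.val i 0 := by
        rw [hM.peak i]
        exact hlam.resolve_right fun hc => hc i hi
      obtain ⟨a, ha⟩ := (h.buyer_active i hi).2.2.2.1.exists_of_le (hM.demand i) hr hle
      exact ⟨a, fun _ => ha, fun hc => absurd hi hc⟩
    · exact ⟨s.x i, fun hc => absurd hc hi, fun _ => rfl⟩
  choose x hx1 hx2 using hx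
  obtain ⟨z, hz⟩ := exists_isMinCostFlow (x := x) (Bs := {i | s.buyer i = Phase.active})
    (Ss := {t | s.item t = Phase.active}) hM.cost fun i hi => by
      obtain ⟨hpos, -, -, -, huse, -⟩ := h.buyer_active i hi
      obtain ⟨t, ht⟩ := h.flow.exists_pos (mem_univ i) hpos
      exact ⟨(hx1 i hi).1, t, huse t ht, (h.flow.mem_of_pos ht).2.2⟩
  exact ⟨x, fun i => if s.buyer i = Phase.active then z i else s.y i, hx1,
    ⟨z, hz, fun i hi => if_pos hi⟩, fun i hi => ⟨hx2 i hi, if_neg hi⟩⟩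

theorem State.IsConsistent.exists_active_item (h : s.IsConsistent M k lam xs ys) {i : B}
    (hi : s.buyer i = Phase.active) : ∃ t, s.item t = Phase.active := by
  obtain ⟨hpos, -, -, -, huse, -⟩ := h.buyer_active i hi
  obtain ⟨t, ht⟩ := h.flow.exists_pos (mem_univ i) hpos
  exact ⟨t, huse t ht⟩

theorem State.IsConsistent.level_lt (hM : M.IsAdmissible k lam xs ys)
    (h : s.IsConsistent M k lam xs ys) {t : S} (ht : s.item t = Phase.active) : s.level < lam :=
  lt_peak_of_not_stops hM.one_lt (h.item_active t ht).2.2.2 (h.item_active t ht).2.2.1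

/-- Demands decrease when the active price rises. -/
theorem IsRepriced.demand_le (hM : M.IsAdmissible k lam xs ys)
    (h : s.IsConsistent M k lam xs ys) {r : ℝ} (hr : s.level ≤ r) {x : B → ℝ} {y : B → S → ℝ}
    (hy : M.IsRepriced s r x y) (i : B) : x i ≤ s.x i := by
  by_cases hi : s.buyer i = Phase.active
  · obtain ⟨-, -, hlt, hbr, -⟩ := h.buyer_active i hi
    exact hbr.le_of_le (hM.demand i) (hM.mhr i) (hy.bestResponse i hi) hr (by rwa [hM.peak i])
  · exact (hy.frozen i hi).1.le

/-- Rising prices shrink demands, and by flow comparison the marginal costs do not rise with them.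
The price therefore outruns the marginal costs, which forces the stopping criterion to be met. -/
theorem IsRepriced.marginal_le_level (hM : M.IsAdmissible k lam xs ys)
    (h : s.IsConsistent M k lam xs ys) {r : ℝ} (hr : s.level ≤ r) {x : B → ℝ} {y : B → S → ℝ}
    (hy : M.IsRepriced s r x y) {t : S} (ht : s.item t = Phase.active) :
    M.marginal t (load y t) ≤ s.level :=
  (h.isServed.marginal_le hM h (hy.isServed hM h) (hy.demand_le hM h hr) ht).trans
    (h.item_active t ht).2.2.1

/-- Below the peak, the marginal costs of the active goods are functions of the active price. -/
theorem IsRepriced.marginal_eq (hM : M.IsAdmissible k lam xs ys)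
    (h : s.IsConsistent M k lam xs ys) {r : ℝ} (hr : r < lam) {x x' : B → ℝ} {y y' : B → S → ℝ}
    (hy : M.IsRepriced s r x y) (hy' : s.IsServed M x' y')
    (hbr : ∀ i, s.buyer i = Phase.active → M.IsBestResponse i r (x' i)) {t : S}
    (ht : s.item t = Phase.active) :
    M.marginal t (load y t) = M.marginal t (load y' t) := by
  have hx : ∀ i, x i = x' i := fun i => by
    by_cases hi : s.buyer i = Phase.active
    · exact (hy.bestResponse i hi).eq (hM.demand i) (hM.mhr i) (hbr i hi) (by rwa [hM.peak i])
    · rw [(hy.frozen i hi).1, (hy'.frozen i hi).1]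
  have hs := hy.isServed hM h
  -- Below the peak the demands are unique, the min-cost flows are not; comparing in both directions
  -- shows that the marginal costs still agree.
  exact le_antisymm (hy'.marginal_le hM h hs (fun i => (hx i).le) ht)
    (hs.marginal_le hM h hy' (fun i => (hx i).ge) ht)

/-- The marginal costs of the active goods depend continuously on the active price. -/
theorem State.IsConsistent.exists_continuousOn_marginal (hM : M.IsAdmissible k lam xs ys)
    (h : s.IsConsistent M k lam xs ys) :
    ∃ G : S → ℝ → ℝ, ∀ t, s.item t = Phase.active →
      ContinuousOn (G t) (Ico s.level lam) ∧ G t s.level = M.marginal t (load s.y t) ∧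
      ∀ r ∈ Ico s.level lam, ∀ x y, M.IsRepriced s r x y → M.marginal t (load y t) = G t r := by
  have hex : ∀ r, ∃ x y, r ∈ Ico s.level lam → M.IsRepriced s r x y := fun r => by
    by_cases hr : r ∈ Ico s.level lam
    · obtain ⟨x, y, hxy⟩ := h.exists_isRepriced hM hr.1 (Or.inl hr.2.le)
      exact ⟨x, y, fun _ => hxy⟩
    · exact ⟨s.x, s.y, fun hc => absurd hc hr⟩
  choose X Y hXY using hex
  refine ⟨fun t r => M.marginal t (load (Y r) t), fun t ht => ⟨fun r hr => ?_, ?_, ?_⟩⟩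
  · have hX : ∀ i, Tendsto (fun u => X u i) (𝓝[Ico s.level lam] r) (𝓝 (X r i)) := fun i => by
      by_cases hi : s.buyer i = Phase.active
      · exact continuousWithinAt_bestResponse (hM.demand i) (hM.mhr i)
          (fun u hu => (hXY u hu).bestResponse i hi) hr (by rw [hM.peak i]; exact hr.2)
      · rw [((hXY r hr).frozen i hi).1]
        refine tendsto_const_nhds.congr' ?_
        filter_upwards [self_mem_nhdsWithin] with u hu using (((hXY u hu).frozen i hi).1).symm
    have hserved : ∀ u ∈ Ico s.level lam, s.IsServed M (X u) (Y u) := fun u hu =>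
      (hXY u hu).isServed hM h
    have hL := (hserved r hr).flow.load_nonneg t
    have hδ : Tendsto (fun u => ∑ i, max (X u i - X r i) 0) (𝓝[Ico s.level lam] r) (𝓝 0) := by
      have := tendsto_finsetSum Finset.univ fun i _ =>
        ((hX i).sub_const (X r i)).max (tendsto_const_nhds (x := (0 : ℝ)))
      simpa using this
    have hδ' : Tendsto (fun u => ∑ i, max (X r i - X u i) 0) (𝓝[Ico s.level lam] r) (𝓝 0) := by
      have := tendsto_finsetSum Finset.univ fun i _ =>
        ((hX i).const_sub (X r i)).max (tendsto_const_nhds (x := (0 : ℝ)))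
      simpa using this
    have hup := (hM.cost t).tendsto_marginal_max hL
      (u := fun u => load (Y r) t + ∑ i, max (X u i - X r i) 0)
      (by simpa using hδ.const_add (load (Y r) t))
    have hlow := (hM.cost t).tendsto_marginal_max hL
      (u := fun u => load (Y r) t - ∑ i, max (X r i - X u i) 0)
      (by simpa using hδ'.const_sub (load (Y r) t))
    -- By flow comparison the marginal cost at `u` lies between those at the load for `r` shifted
    -- down and up by the total change of demand, which tends to `0`. The lower shift is cut off at
    -- `0`, where costs begin.
    refine tendsto_of_tendsto_of_tendsto_of_le_of_le' hlow hup ?_ ?_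
    · filter_upwards [self_mem_nhdsWithin] with u hu
      have h0 : 0 ≤ ∑ i, max (X r i - X u i) 0 := Finset.sum_nonneg fun i _ => le_max_right _ _
      rcases (hserved u hu).load_le_or_marginal_le hM h (hserved r hr) ht with hc | hc
      · exact (hM.cost t).marginal_mono (le_max_right _ _)
          (max_le (by linarith) ((hserved u hu).flow.load_nonneg t))
      · exact ((hM.cost t).marginal_mono (le_max_right _ _) (max_le (by linarith) hL)).trans hc
    · filter_upwards [self_mem_nhdsWithin] with u hu
      have h0 : 0 ≤ ∑ i, max (X u i - X r i) 0 := Finset.sum_nonneg fun i _ => le_max_right _ _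
      rcases (hserved r hr).load_le_or_marginal_le hM h (hserved u hu) ht with hc | hc
      · exact (hM.cost t).marginal_mono ((hserved u hu).flow.load_nonneg t)
          (hc.trans (le_max_left _ _))
      · exact hc.trans ((hM.cost t).marginal_mono hL (le_trans (by linarith) (le_max_left _ _)))
  · exact (hXY _ ⟨le_rfl, h.level_lt hM ht⟩).marginal_eq hM h (h.level_lt hM ht) h.isServed
      (fun i hi => (h.buyer_active i hi).2.2.2.1) ht
  · intro r hr x y hxy
    exact hxy.marginal_eq hM h hr.2 ((hXY r hr).isServed hM h) (hXY r hr).bestResponse ht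

end Market

/-! ### Each stage preserves the invariant. -/

namespace Market

open Set Filter Topology MeasureTheory

variable {B S : Type*} [Fintype B] [Fintype S] {M : Market B S} {k lam : ℝ} {xs : B → ℝ}
  {ys : B → S → ℝ} {s s' : State B S}

theorem isConsistent_startState (hM : M.IsAdmissible k lam xs ys) {l : ℝ}
    (hl : ∀ t, l < M.initialPrice ys t) : (M.startState xs ys l).IsConsistent M k lam xs ys where
  flow := hM.envyFree.flow
  item_inactive t _ := ⟨rfl, hl t, rfl⟩
  item_active t h := by simp [startState] at h
  item_finished t h := by simp [startState] at h
  buyer_inactive i _ := ⟨rfl, rfl, fun _ _ => rfl⟩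
  buyer_active i h := by simp [startState] at h
  equilibrated i hi := by simp [startState] at hi
  buyer_finished i h := by simp [startState] at h

/-- All active goods reach the stopping criterion below the peak. -/
theorem IsRepriced.stops (hM : M.IsAdmissible k lam xs ys) (h : s.IsConsistent M k lam xs ys)
    {r : ℝ} (hr : s.level + 1 / k * (lam - s.level) ≤ r) (hlr : s.level ≤ r) {x : B → ℝ}
    {y : B → S → ℝ} (hy : M.IsRepriced s r x y) {t : S} (ht : s.item t = Phase.active) :
    Stops k lam r (M.marginal t (load y t)) := by
  have hle := hy.marginal_le_level hM h hlr ht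
  have hk := hM.one_lt
  have hk' : 1 / k < 1 := (div_lt_one (one_pos.trans hk)).2 hk
  unfold Stops
  nlinarith

/-- The price `l + (lam - l) / k` is the one at which marginal cost `l` meets the criterion; smaller
marginal costs meet it earlier. -/
theorem level_add_lt (hk : 1 < k) {l : ℝ} (hl : l < lam) :
    l < l + 1 / k * (lam - l) ∧ l + 1 / k * (lam - l) < lam := by
  have hk0 : 0 < 1 / k := by positivity
  have hk' : 1 / k < 1 := (div_lt_one (one_pos.trans hk)).2 hk
  constructor <;> nlinarith

namespace Step

/-- Otherwise the stage would pass the price `s.level + (lam - s.level) / k`, at which every active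
good already meets the criterion. -/
theorem level_lt (hM : M.IsAdmissible k lam xs ys) (h : s.IsConsistent M k lam xs ys)
    (hstep : M.Step k lam s s') {t : S} (ht : s.item t = Phase.active) : s'.level < lam := by
  by_contra! hle
  obtain ⟨h1, h2⟩ := level_add_lt hM.one_lt (h.level_lt hM ht)
  obtain ⟨x, y, hxy⟩ := h.exists_isRepriced hM h1.le (Or.inl h2.le)
  exact hstep.no_stop_between _ h1 (h2.trans_le hle) x y hxy t ht (hxy.stops hM h le_rfl h1.le ht)

/-- A good that was active before it stops does so with equality in the stopping criterion. -/
theorem margin_eq (hM : M.IsAdmissible k lam xs ys) (h : s.IsConsistent M k lam xs ys)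
    (hstep : M.Step k lam s s') {t : S} (ht : s.item t = Phase.active)
    (hstops : Stops k lam s'.level (M.marginal t (load s'.y t))) :
    s'.level - M.marginal t (load s'.y t) = 1 / k * (lam - M.marginal t (load s'.y t)) := by
  refine le_antisymm ?_ hstops
  have hq := hstep.level_lt hM h ht
  obtain ⟨G, hG⟩ := h.exists_continuousOn_marginal hM
  obtain ⟨hc, -, heq⟩ := hG t ht
  have hmem : s'.level ∈ Ico s.level lam := ⟨hstep.rise.le, hq⟩
  rw [heq _ hmem _ _ hstep.repriced]
  have hsub : Ioo s.level s'.level ⊆ Ico s.level lam := fun r hr => ⟨hr.1.le, hr.2.trans hq⟩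
  have hG' : Tendsto (G t) (𝓝[Ioo s.level s'.level] s'.level) (𝓝 (G t s'.level)) :=
    (hc _ hmem).tendsto.mono_left (nhdsWithin_mono _ hsub)
  have hid : Tendsto (fun r : ℝ => r) (𝓝[Ioo s.level s'.level] s'.level) (𝓝 s'.level) :=
    nhdsWithin_le_nhds
  have : (𝓝[Ioo s.level s'.level] s'.level).NeBot := right_nhdsWithin_Ioo_neBot hstep.rise
  -- Just below the new level the criterion fails; the limit from the left, by continuity of the
  -- marginal cost, gives the reverse inequality.
  refine le_of_tendsto_of_tendsto (hid.sub hG') ((hG'.const_sub lam).const_mul (1 / k)) ?_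
  filter_upwards [self_mem_nhdsWithin] with r hr
  obtain ⟨x, y, hxy⟩ := h.exists_isRepriced hM hr.1.le (Or.inl (hsub hr).2.le)
  have hns := hstep.no_stop_between r hr.1 hr.2 x y hxy t ht
  rw [heq _ (hsub hr) _ _ hxy] at hns
  exact (not_le.1 hns).le

theorem marginal_of_joins (hM : M.IsAdmissible k lam xs ys) (h : s.IsConsistent M k lam xs ys)
    (hstep : M.Step k lam s s') {t : S} (ht : s.ItemJoins s'.level t) :
    M.marginal t (load s'.y t) = s'.level ∧ M.initialPrice ys t = s'.level := by
  obtain ⟨hp, -, hc⟩ := h.item_inactive t ht.1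
  rw [(hstep.repriced.isServed hM h).load_eq h (by simp [ht.1]), hc, ← hp]
  exact ⟨ht.2, ht.2⟩

/-- A joining good is priced exactly at its marginal cost, so its margin is zero. -/
theorem stops_of_joins (hM : M.IsAdmissible k lam xs ys) (h : s.IsConsistent M k lam xs ys)
    (hstep : M.Step k lam s s') {t : S} (ht : s.ItemJoins s'.level t) :
    Stops k lam s'.level (M.marginal t (load s'.y t)) ↔ lam ≤ s'.level := by
  rw [(hstep.marginal_of_joins hM h ht).1, stops_self_iff hM.one_lt]

theorem item_eq_active_iff (hstep : M.Step k lam s s') (t : S) :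
    s'.item t = Phase.active ↔ (s.item t = Phase.active ∨ s.ItemJoins s'.level t) ∧
      ¬ s.ItemStops M k lam s'.level s'.y t := by
  have h1 := hstep.item_inactive t
  have h2 := hstep.item_finished t
  constructor
  · intro h
    simp only [h, reduceCtorEq, false_iff, not_or, not_and, not_not] at h1 h2
    refine ⟨?_, h2.2⟩
    cases hs : s.item t with
    | inactive => exact Or.inr (h1 hs)
    | active => exact Or.inl rfl
    | finished => exact absurd hs h2.1
  · rintro ⟨ha, hns⟩
    cases hs : s'.item t with
    | inactive =>
      have := h1.1 hs
      rcases ha with ha | ha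
      · simp [this.1] at ha
      · exact absurd ha this.2
    | active => rfl
    | finished =>
      rcases h2.1 hs with hf | hf
      · rcases ha with ha | ha
        · simp [hf] at ha
        · simp [ha.1] at hf
      · exact absurd hf hns

theorem buyer_eq_active (hstep : M.Step k lam s s') {i : B} (h : s'.buyer i = Phase.active) :
    (s.buyer i = Phase.active ∨ s.BuyerJoins s'.level i) ∧
      ¬ s.BuyerStops M k lam s'.level s'.y i := by
  have h1 := hstep.buyer_inactive i
  have h2 := hstep.buyer_finished i
  simp only [h, reduceCtorEq, false_iff, not_or, not_and, not_not] at h1 h2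
  refine ⟨?_, h2.2⟩
  cases hs : s.buyer i with
  | inactive => exact Or.inr (h1 hs)
  | active => exact Or.inl rfl
  | finished => exact absurd hs h2.1

theorem price_of_active_or_joins (hstep : M.Step k lam s s') {t : S}
    (ht : s.item t = Phase.active ∨ s.ItemJoins s'.level t) : s'.price t = s'.level := by
  rcases ht with ht | ht
  · exact hstep.price_active t ht
  · rw [hstep.price_other t (by simp [ht.1]), ht.2]

theorem initialPrice_le_level (h : s.IsConsistent M k lam xs ys) {t : S}
    (ht : s.item t ≠ Phase.inactive) : M.initialPrice ys t ≤ s.level := by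
  cases hs : s.item t with
  | inactive => exact absurd hs ht
  | active => exact (h.item_active t hs).2.1
  | finished => exact (h.item_finished t hs).1.trans (h.item_finished t hs).2.1

/-- The goods used by a buyer type that joins, and the goods it desires. -/
theorem joins_of_buyerJoins (hM : M.IsAdmissible k lam xs ys) (h : s.IsConsistent M k lam xs ys)
    {q : ℝ} (hq : s.level < q) {i : B} (hi : s.BuyerJoins q i) :
    s.x i = xs i ∧ s.y i = ys i ∧ (∃ t, 0 < ys i t ∧ M.initialPrice ys t = q) ∧
      (∀ t, 0 < ys i t → s.ItemJoins q t) ∧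
      ∀ t ∈ M.desired i, s.item t = Phase.inactive ∧ q ≤ M.initialPrice ys t := by
  obtain ⟨hin, t0, ht0, hpos0⟩ := hi
  obtain ⟨hx, hy, huse⟩ := h.buyer_inactive i hin
  rw [hy] at hpos0 huse
  have hP0 : M.initialPrice ys t0 = q := by rw [← (h.item_inactive t0 ht0.1).1]; exact ht0.2
  have hdes : ∀ t ∈ M.desired i, q ≤ M.initialPrice ys t := fun t ht => by
    rw [← hP0]; exact hM.initialPrice_le hpos0 ht
  refine ⟨hx, hy, ⟨t0, hpos0, hP0⟩, fun t ht => ⟨huse t ht, ?_⟩, fun t ht => ⟨?_, hdes t ht⟩⟩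
  · rw [(h.item_inactive t (huse t ht)).1]
    refine le_antisymm ?_ (hdes t (hM.envyFree.flow.mem_of_pos ht).2.2)
    rw [← hP0]
    exact hM.initialPrice_le ht (hM.envyFree.flow.mem_of_pos hpos0).2.2
  -- A good that has left the inactive set has initial price at most `s.level < q`, but desired
  -- goods have initial price at least `q`.
  · by_contra hc
    linarith [initialPrice_le_level h hc, hdes t ht]

theorem not_active_of_joins (h : s.IsConsistent M k lam xs ys) (hM : M.IsAdmissible k lam xs ys)
    {q : ℝ} (hq : s.level < q) {i : B} (hi : s.BuyerJoins q i) {t : S} (ht : t ∈ M.desired i)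
    (hact : s.item t = Phase.active ∨ s.ItemJoins q t) : s.ItemJoins q t :=
  hact.resolve_left fun hc => by
    simp [((joins_of_buyerJoins hM h hq hi).2.2.2.2 t ht).1] at hc

theorem marginal_lt_level (hM : M.IsAdmissible k lam xs ys) (h : s.IsConsistent M k lam xs ys)
    (hstep : M.Step k lam s s') {t : S} (ht : s.item t = Phase.active) :
    M.marginal t (load s'.y t) < s'.level :=
  (hstep.repriced.marginal_le_level hM h hstep.rise.le ht).trans_lt hstep.rise

theorem consistent_buyer_active (hM : M.IsAdmissible k lam xs ys)
    (h : s.IsConsistent M k lam xs ys) (hstep : M.Step k lam s s') {i : B}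
    (hi : s'.buyer i = Phase.active) :
    0 < s'.x i ∧ s'.x i ≤ xs i ∧ s'.level < lam ∧ M.IsBestResponse i s'.level (s'.x i) ∧
      (∀ t, 0 < s'.y i t → s'.item t = Phase.active) ∧
      ∀ t ∈ M.desired i, s'.item t ≠ Phase.finished := by
  have hserved := hstep.repriced.isServed hM h
  obtain ⟨hact | hjoin, hns⟩ := hstep.buyer_eq_active hi
  · obtain ⟨t0, ht0⟩ := h.exists_active_item hact
    have hq := hstep.level_lt hM h ht0
    obtain ⟨-, hxs, -, -, -, hnf⟩ := h.buyer_active i hact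
    have hbr := hstep.repriced.bestResponse i hact
    have hpos := hbr.pos (hM.demand i) (by rwa [hM.peak i])
    have huse : ∀ t, 0 < s'.y i t → s'.item t = Phase.active := fun t ht =>
      (hstep.item_eq_active_iff t).2 ⟨Or.inl (hserved.active i hact t ht),
        fun hst => hns ⟨Or.inl hact, t, hst, ht⟩⟩
    refine ⟨hpos, (hstep.repriced.demand_le hM h hstep.rise.le i).trans hxs, hq, hbr, huse,
      fun t ht hfin => ?_⟩
    rcases (hstep.item_finished t).1 hfin with hf | ⟨ha | hj, hst⟩
    · exact hnf t ht hf
    -- If a desired active good stops, then so does any good `t'` that `i` uses, since its marginal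
    -- cost is no larger. But `i` uses only goods that stay active.
    · obtain ⟨t', ht'⟩ := hserved.flow.exists_pos (mem_univ i) hpos
      have hle := hserved.equilibrated i hact t' t ht' ha ht
      exact ((hstep.item_eq_active_iff t').1 (huse t' ht')).2
        ⟨Or.inl (hserved.active i hact t' ht'), hst.mono hM.one_lt hle⟩
    · exact hq.not_ge ((hstep.stops_of_joins hM h hj).1 hst)
  · obtain ⟨hx, hy, ⟨t0, ht0, hP0⟩, huse, hdes⟩ := joins_of_buyerJoins hM h hstep.rise hjoin
    have hne : s.buyer i ≠ Phase.active := by simp [hjoin.1]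
    rw [(hstep.repriced.frozen i hne).1, (hstep.repriced.frozen i hne).2, hx, hy]
    have hns' : ∀ t, 0 < ys i t → ¬ s.ItemStops M k lam s'.level s'.y t := fun t ht hst =>
      hns ⟨Or.inr hjoin, t, hst, by rwa [(hstep.repriced.frozen i hne).2, hy]⟩
    have hq : s'.level < lam := by
      by_contra! hle
      exact hns' t0 ht0 ⟨Or.inr (huse t0 ht0), (hstep.stops_of_joins hM h (huse t0 ht0)).2 hle⟩
    refine ⟨ht0.trans_le (hM.envyFree.flow.le_total (mem_univ i) t0), le_rfl, hq, ?_,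
      fun t ht => (hstep.item_eq_active_iff t).2 ⟨Or.inr (huse t ht), hns' t ht⟩,
      fun t ht hfin => ?_⟩
    · rw [← hP0]; exact hM.bestResponse ht0
    · rcases (hstep.item_finished t).1 hfin with hf | ⟨ha, hst⟩
      · simp [(hdes t ht).1] at hf
      · exact hq.not_ge
          ((hstep.stops_of_joins hM h (not_active_of_joins h hM hstep.rise hjoin ht ha)).1 hst)

/-- Joining goods have marginal cost equal to the new level, which is above that of the goods
already active, so they do not undercut them. Joining buyers reach no good that was active before.
-/
theorem consistent_equilibrated (hM : M.IsAdmissible k lam xs ys)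
    (h : s.IsConsistent M k lam xs ys) (hstep : M.Step k lam s s') :
    M.IsEquilibrated {i | s'.buyer i = Phase.active} {t | s'.item t = Phase.active} s'.y := by
  intro i hi t t' hpos ht' hd'
  have hserved := hstep.repriced.isServed hM h
  obtain ⟨hact', -⟩ := (hstep.item_eq_active_iff t').1 ht'
  obtain ⟨hact | hjoin, -⟩ := hstep.buyer_eq_active hi
  · rcases hact' with ha | hj
    · exact hserved.equilibrated i hact t t' hpos ha hd'
    · rw [(hstep.marginal_of_joins hM h hj).1]
      exact (hstep.marginal_lt_level hM h (hserved.active i hact t hpos)).le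
  · obtain ⟨-, hy, -, huse, -⟩ := joins_of_buyerJoins hM h hstep.rise hjoin
    rw [(hstep.repriced.frozen i (by simp [hjoin.1])).2, hy] at hpos
    rw [(hstep.marginal_of_joins hM h (huse t hpos)).1, (hstep.marginal_of_joins hM h
      (not_active_of_joins h hM hstep.rise hjoin hd' hact')).1]

theorem consistent_buyer_finished (hM : M.IsAdmissible k lam xs ys)
    (h : s.IsConsistent M k lam xs ys) (hstep : M.Step k lam s s') {i : B}
    (hi : s'.buyer i = Phase.finished) :
    ∃ q, M.IsBestResponse i q (s'.x i) ∧ s'.x i ≤ xs i ∧ (lam ≤ q → s'.x i = xs i) ∧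
      (∀ t, 0 < s'.y i t → s'.item t = Phase.finished ∧ s'.price t = q) ∧
      (∀ t ∈ M.desired i, s'.item t = Phase.finished → q ≤ s'.price t) ∧
      ∃ t ∈ M.desired i, s'.item t = Phase.finished ∧ s'.price t = q := by
  have hserved := hstep.repriced.isServed hM h
  have hold : ∀ t, s.item t = Phase.finished →
      s'.item t = Phase.finished ∧ s'.price t = s.price t := fun t ht =>
    ⟨(hstep.item_finished t).2 (Or.inl ht), hstep.price_other t (by simp [ht])⟩
  have hnew : ∀ t, s.ItemStops M k lam s'.level s'.y t →
      s'.item t = Phase.finished ∧ s'.price t = s'.level := fun t ht =>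
    ⟨(hstep.item_finished t).2 (Or.inr ht), hstep.price_of_active_or_joins ht.1⟩
  rcases (hstep.buyer_finished i).1 hi with hf | ⟨hact | hjoin, t0, hst0, hpos0⟩
  · obtain ⟨q, hbr, hxs, hlam, huse, hdes, t0, ht0, hf0, hp0⟩ := h.buyer_finished i hf
    have hne : s.buyer i ≠ Phase.active := by simp [hf]
    rw [(hstep.repriced.frozen i hne).1, (hstep.repriced.frozen i hne).2]
    refine ⟨q, hbr, hxs, hlam, fun t ht => ?_, fun t ht hfin => ?_, t0, ht0, (hold t0 hf0).1,
      by rw [(hold t0 hf0).2, hp0]⟩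
    · obtain ⟨h1, h2⟩ := huse t ht
      exact ⟨(hold t h1).1, by rw [(hold t h1).2, h2]⟩
    · rcases (hstep.item_finished t).1 hfin with hft | hst
      · rw [(hold t hft).2]; exact hdes t ht hft
      -- Goods that finish later do so at a higher level, so they never become cheaper than the
      -- price `q` already fixed for `i`.
      · rw [(hnew t hst).2, ← hp0]
        exact (h.item_finished t0 hf0).2.1.trans hstep.rise.le
  · obtain ⟨-, hxs, -, -, -, hnf⟩ := h.buyer_active i hact
    have ha0 := hserved.active i hact t0 hpos0
    have hd0 := (hserved.flow.mem_of_pos hpos0).2.2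
    refine ⟨s'.level, hstep.repriced.bestResponse i hact,
      (hstep.repriced.demand_le hM h hstep.rise.le i).trans hxs,
      fun hle => absurd hle (hstep.level_lt hM h ha0).not_ge, fun t ht => ?_,
      fun t ht hfin => ?_, t0, hd0, hnew t0 hst0⟩
    · exact hnew t ⟨Or.inl (hserved.active i hact t ht),
        hst0.2.mono hM.one_lt (hserved.equilibrated i hact t t0 ht ha0 hd0)⟩
    · rcases (hstep.item_finished t).1 hfin with hft | hst
      · exact absurd hft (hnf t ht)
      · rw [(hnew t hst).2]
  · obtain ⟨hx, hy, ⟨t1, ht1, hP1⟩, huse, hdes⟩ := joins_of_buyerJoins hM h hstep.rise hjoin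
    have hne : s.buyer i ≠ Phase.active := by simp [hjoin.1]
    rw [(hstep.repriced.frozen i hne).2, hy] at hpos0
    rw [(hstep.repriced.frozen i hne).1, (hstep.repriced.frozen i hne).2, hx, hy]
    -- A joining buyer can stop at once only at or above the peak, and then all the goods it uses
    -- stop with it and it keeps its optimal allocation.
    have hle := (hstep.stops_of_joins hM h (huse t0 hpos0)).1 hst0.2
    have huse' : ∀ t, 0 < ys i t → s.ItemStops M k lam s'.level s'.y t := fun t ht =>
      ⟨Or.inr (huse t ht), (hstep.stops_of_joins hM h (huse t ht)).2 hle⟩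
    refine ⟨s'.level, by rw [← hP1]; exact hM.bestResponse ht1, le_rfl, fun _ => rfl,
      fun t ht => hnew t (huse' t ht), fun t ht hfin => ?_, t0,
      (hM.envyFree.flow.mem_of_pos hpos0).2.2, hnew t0 hst0⟩
    rcases (hstep.item_finished t).1 hfin with hft | hst
    · simp [(hdes t ht).1] at hft
    · rw [(hnew t hst).2]

theorem isConsistent (hM : M.IsAdmissible k lam xs ys) (h : s.IsConsistent M k lam xs ys)
    (hstep : M.Step k lam s s') : s'.IsConsistent M k lam xs ys where
  flow := (hstep.repriced.isServed hM h).flow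
  item_inactive t ht := by
    obtain ⟨hin, hnj⟩ := (hstep.item_inactive t).1 ht
    obtain ⟨hp, hl, hc⟩ := h.item_inactive t hin
    rw [hstep.price_other t (by simp [hin]),
      (hstep.repriced.isServed hM h).load_eq h (by simp [hin])]
    refine ⟨hp, ?_, hc⟩
    by_contra! hle
    rcases hle.lt_or_eq with hlt | heq
    · exact hstep.no_join_between _ hl hlt t ⟨hin, hp⟩
    · exact hnj ⟨hin, hp.trans heq⟩
  item_active t ht := by
    obtain ⟨ha, hns⟩ := (hstep.item_eq_active_iff t).1 ht
    refine ⟨hstep.price_of_active_or_joins ha, ?_, ?_, fun hst => hns ⟨ha, hst⟩⟩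
    · rcases ha with ha | hj
      · exact (h.item_active t ha).2.1.trans hstep.rise.le
      · exact (hstep.marginal_of_joins hM h hj).2.le
    · rcases ha with ha | hj
      · exact (hstep.marginal_lt_level hM h ha).le
      · exact (hstep.marginal_of_joins hM h hj).1.le
  item_finished t ht := by
    rcases (hstep.item_finished t).1 ht with hf | ⟨ha | hj, hst⟩
    · obtain ⟨h1, h2, h3⟩ := h.item_finished t hf
      rw [hstep.price_other t (by simp [hf]),
        (hstep.repriced.isServed hM h).load_eq h (by simp [hf])]
      exact ⟨h1, h2.trans hstep.rise.le, h3⟩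
    · rw [hstep.price_active t ha]
      exact ⟨(h.item_active t ha).2.1.trans hstep.rise.le, le_rfl,
        Or.inr ⟨hstep.level_lt hM h ha, hstep.margin_eq hM h ha hst⟩⟩
    · rw [hstep.price_of_active_or_joins (Or.inr hj), (hstep.marginal_of_joins hM h hj).1,
        (hstep.marginal_of_joins hM h hj).2]
      exact ⟨le_rfl, le_rfl, Or.inl ⟨(hstep.stops_of_joins hM h hj).1 hst, rfl⟩⟩
  buyer_inactive i hi := by
    obtain ⟨hin, hnj⟩ := (hstep.buyer_inactive i).1 hi
    have hne : s.buyer i ≠ Phase.active := by simp [hin]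
    obtain ⟨hx, hy, huse⟩ := h.buyer_inactive i hin
    rw [(hstep.repriced.frozen i hne).1, (hstep.repriced.frozen i hne).2]
    exact ⟨hx, hy, fun t ht => (hstep.item_inactive t).2
      ⟨huse t ht, fun hj => hnj ⟨hin, t, hj, ht⟩⟩⟩
  buyer_active i hi := hstep.consistent_buyer_active hM h hi
  equilibrated := hstep.consistent_equilibrated hM h
  buyer_finished i hi := hstep.consistent_buyer_finished hM h hi

end Step

theorem isConsistent_of_reflTransGen (hM : M.IsAdmissible k lam xs ys)
    (h : s.IsConsistent M k lam xs ys) (hs : Relation.ReflTransGen (M.Step k lam) s s') :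
    s'.IsConsistent M k lam xs ys := by
  induction hs with
  | refl => exact h
  | tail _ hstep ih => exact hstep.isConsistent hM ih

end Market

/-! ### Progress and termination. -/

namespace Market

open Set Filter Topology MeasureTheory

variable {B S : Type*} [Fintype B] [Fintype S] {M : Market B S} {k lam : ℝ} {xs : B → ℝ}
  {ys : B → S → ℝ} {s s' : State B S}

/-- The number of phases a good still has to pass. -/
def Phase.remaining : Phase → ℕ
  | inactive => 2
  | active => 1
  | finished => 0

/-- The number of activations and terminations of goods still to come. -/
def State.remaining (s : State B S) : ℕ := ∑ t, (s.item t).remaining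

theorem Step.remaining_lt (hstep : M.Step k lam s s') {t : S} (ht : s'.item t ≠ s.item t) :
    s'.remaining < s.remaining := by
  have key : ∀ u, (s'.item u).remaining ≤ (s.item u).remaining ∧
      (s'.item u ≠ s.item u → (s'.item u).remaining < (s.item u).remaining) := fun u => by
    have h1 := hstep.item_inactive u
    have h2 := hstep.item_finished u
    cases hs : s.item u <;> cases hs' : s'.item u <;> simp_all [Phase.remaining]
  exact Finset.sum_lt_sum (fun u _ => (key u).1) ⟨t, Finset.mem_univ t, (key t).2 ht⟩

/-- The stage that raises the active price to `q`. -/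
theorem exists_step_of_isRepriced {q : ℝ} {x : B → ℝ} {y : B → S → ℝ}
    (hrise : s.level < q) (hxy : M.IsRepriced s q x y)
    (hjoin : ∀ t, s.item t = Phase.inactive → q ≤ s.price t)
    (hstops : ∀ r, s.level < r → r < q → ∀ x y, M.IsRepriced s r x y →
      ∀ t, s.item t = Phase.active → ¬ Stops k lam r (M.marginal t (load y t))) :
    ∃ s', M.Step k lam s s' ∧ s'.level = q ∧ s'.y = y := by
  classical
  -- `finished` is tested first, so a good or buyer that joins and stops at the same price skips the
  -- active phase.
  refine ⟨⟨q, fun t => if s.item t = Phase.active then q else s.price t, x, y,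
    fun t => if s.item t = Phase.finished ∨ s.ItemStops M k lam q y t then Phase.finished
      else if s.item t = Phase.inactive ∧ ¬ s.ItemJoins q t then Phase.inactive else Phase.active,
    fun i => if s.buyer i = Phase.finished ∨ s.BuyerStops M k lam q y i then Phase.finished
      else if s.buyer i = Phase.inactive ∧ ¬ s.BuyerJoins q i then Phase.inactive
      else Phase.active⟩, ?_, rfl, rfl⟩
  refine ⟨hrise, fun r _ hr t ht => ?_, hstops, hxy, fun t ht => if_pos ht, fun t ht => if_neg ht,
    fun t => ?_, fun t => ?_, fun i => ?_, fun i => ?_⟩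
  · exact hr.not_ge (ht.2 ▸ hjoin t ht.1)
  · dsimp only
    split_ifs with h1 h2
    · refine ⟨fun h => absurd h (by simp), fun h => ?_⟩
      rcases h1 with h1 | ⟨h1 | h1, -⟩
      · simp [h1] at h
      · simp [h1] at h
      · exact absurd h1 h.2
    · simpa using h2
    · simpa using h2
  · dsimp only
    split_ifs with h1 h2
    · simpa using h1
    · simpa using h1
    · simpa using h1
  · dsimp only
    split_ifs with h1 h2
    · refine ⟨fun h => absurd h (by simp), fun h => ?_⟩
      rcases h1 with h1 | ⟨h1 | h1, -⟩
      · simp [h1] at h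
      · simp [h1] at h
      · exact absurd h1 h.2
    · simpa using h2
    · simpa using h2
  · dsimp only
    split_ifs with h1 h2
    · simpa using h1
    · simpa using h1
    · simpa using h1

/-- The next price at which an active good stops, if no inactive good joins before. -/
theorem State.IsConsistent.exists_stop_price (hM : M.IsAdmissible k lam xs ys)
    (h : s.IsConsistent M k lam xs ys) (hact : ∃ t, s.item t = Phase.active) :
    ∃ q, s.level < q ∧ q < lam ∧
      (∀ r, s.level < r → r < q → ∀ x y, M.IsRepriced s r x y →
        ∀ t, s.item t = Phase.active → ¬ Stops k lam r (M.marginal t (load y t))) ∧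
      ∀ x y, M.IsRepriced s q x y →
        ∃ t, s.item t = Phase.active ∧ Stops k lam q (M.marginal t (load y t)) := by
  obtain ⟨t0, ht0⟩ := hact
  obtain ⟨h1, h2⟩ := level_add_lt hM.one_lt (h.level_lt hM ht0)
  set r1 := s.level + 1 / k * (lam - s.level) with hr1
  obtain ⟨G, hG⟩ := h.exists_continuousOn_marginal hM
  have hsub : Icc s.level r1 ⊆ Ico s.level lam := fun r hr => ⟨hr.1, hr.2.trans_lt h2⟩
  -- The prices at which some active good stops. Continuity of the marginal costs makes the set
  -- compact, `r1` lies in it, and its least element is the next stopping price. That element is not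
  -- `s.level`, by the invariant.
  set E : Set ℝ := ⋃ t : {t // s.item t = Phase.active},
    {r | r ∈ Icc s.level r1 ∧ 1 / k * (lam - G t r) ≤ r - G t r} with hE
  have hEc : IsCompact E := isCompact_iUnion fun t => by
    have hc : ContinuousOn (G t) (Icc s.level r1) := (hG t t.2).1.mono hsub
    refine isCompact_Icc.of_isClosed_subset (isClosed_Icc.isClosed_le ?_ ?_) fun r hr => hr.1
    · exact continuousOn_const.mul (continuousOn_const.sub hc)
    · exact continuousOn_id.sub hc
  have hEne : E.Nonempty := by
    obtain ⟨x, y, hxy⟩ := h.exists_isRepriced hM h1.le (Or.inl h2.le)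
    have hst := hxy.stops hM h le_rfl h1.le ht0
    rw [(hG t0 ht0).2.2 r1 (hsub (right_mem_Icc.2 h1.le)) x y hxy] at hst
    exact ⟨r1, mem_iUnion.2 ⟨⟨t0, ht0⟩, right_mem_Icc.2 h1.le, hst⟩⟩
  obtain ⟨q, hq, hmin⟩ := hEc.exists_isLeast hEne
  obtain ⟨⟨t, ht⟩, hqI, hst⟩ := mem_iUnion.1 hq
  refine ⟨q, lt_of_le_of_ne hqI.1 ?_, (hsub hqI).2, fun r hr hrq x y hxy u hu hstops => ?_,
    fun x y hxy => ⟨t, ht, ?_⟩⟩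
  · rintro rfl
    simp only [(hG t ht).2.1] at hst
    exact (h.item_active t ht).2.2.2 hst
  · have hrI : r ∈ Icc s.level r1 := ⟨hr.le, hrq.le.trans hqI.2⟩
    rw [(hG u hu).2.2 r (hsub hrI) x y hxy] at hstops
    exact hrq.not_ge (hmin (mem_iUnion.2 ⟨⟨u, hu⟩, hrI, hstops⟩))
  · rw [(hG t ht).2.2 q (hsub hqI) x y hxy]
    exact hst

/-- The procedure never gets stuck, and every stage up to the next event makes progress. -/
theorem State.IsConsistent.exists_step (hM : M.IsAdmissible k lam xs ys)
    (h : s.IsConsistent M k lam xs ys) (hne : ∃ t, s.item t ≠ Phase.finished) :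
    ∃ s', M.Step k lam s s' ∧ s'.remaining < s.remaining := by
  classical
  have hjoinstep : ∀ q t, s.level < q → s.item t = Phase.inactive → s.price t = q →
      (∀ u, s.item u = Phase.inactive → q ≤ s.price u) →
      (q ≤ lam ∨ ∀ i, s.buyer i ≠ Phase.active) →
      (∀ r, s.level < r → r < q → ∀ x y, M.IsRepriced s r x y →
        ∀ t, s.item t = Phase.active → ¬ Stops k lam r (M.marginal t (load y t))) →
      ∃ s', M.Step k lam s s' ∧ s'.remaining < s.remaining := by
    intro q t hl hin hp hmin hlam hns
    obtain ⟨x, y, hxy⟩ := h.exists_isRepriced hM hl.le hlam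
    obtain ⟨s', hs', rfl, -⟩ := exists_step_of_isRepriced hl hxy hmin hns
    refine ⟨s', hs', hs'.remaining_lt (t := t) fun heq => ?_⟩
    exact ((hs'.item_inactive t).1 (heq.trans hin)).2 ⟨hin, hp⟩
  have hstopstep : ∀ q, s.level < q → q ≤ lam →
      (∀ u, s.item u = Phase.inactive → q ≤ s.price u) →
      (∀ r, s.level < r → r < q → ∀ x y, M.IsRepriced s r x y →
        ∀ t, s.item t = Phase.active → ¬ Stops k lam r (M.marginal t (load y t))) →
      (∀ x y, M.IsRepriced s q x y →
        ∃ t, s.item t = Phase.active ∧ Stops k lam q (M.marginal t (load y t))) →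
      ∃ s', M.Step k lam s s' ∧ s'.remaining < s.remaining := by
    intro q hl hlam hmin hns hst
    obtain ⟨x, y, hxy⟩ := h.exists_isRepriced hM hl.le (Or.inl hlam)
    obtain ⟨t, ht, hstops⟩ := hst x y hxy
    obtain ⟨s', hs', rfl, rfl⟩ := exists_step_of_isRepriced hl hxy hmin hns
    refine ⟨s', hs', hs'.remaining_lt (t := t) fun heq => ?_⟩
    have := (hs'.item_finished t).2 (Or.inr ⟨Or.inl ht, hstops⟩)
    simp [heq, ht] at this
  by_cases hin : ∃ t, s.item t = Phase.inactive
  · obtain ⟨t, ht, hmin⟩ := Finset.exists_min_image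
      ({t | s.item t = Phase.inactive} : Finset S) s.price (by
        obtain ⟨t, ht⟩ := hin
        exact ⟨t, by simpa using ht⟩)
    simp only [Finset.mem_filter, Finset.mem_univ, true_and] at ht hmin
    have hl : s.level < s.price t := by
      rw [(h.item_inactive t ht).1]; exact (h.item_inactive t ht).2.1
    -- The next event is the smaller of the next stopping price and the least inactive price.
    -- Without active goods there are no active buyers either, and the price may jump beyond the
    -- peak.
    by_cases hact : ∃ t, s.item t = Phase.active
    · obtain ⟨q, hq1, hq2, hns, hst⟩ := h.exists_stop_price hM hact
      rcases le_or_gt q (s.price t) with hle | hgt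
      · exact hstopstep q hq1 hq2.le (fun u hu => hle.trans (hmin u hu)) hns hst
      · exact hjoinstep _ t hl ht rfl hmin (Or.inl (hgt.trans hq2).le)
          fun r hr hrq => hns r hr (hrq.trans hgt)
    · exact hjoinstep _ t hl ht rfl hmin (Or.inr fun i hi => hact (h.exists_active_item hi))
        fun r _ _ x y _ u hu => absurd ⟨u, hu⟩ hact
  · have hact : ∃ t, s.item t = Phase.active := by
      obtain ⟨t, ht⟩ := hne
      refine ⟨t, ?_⟩
      cases hs : s.item t with
      | inactive => exact absurd ⟨t, hs⟩ hin
      | active => rfl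
      | finished => exact absurd hs ht
    obtain ⟨q, hq1, hq2, hns, hst⟩ := h.exists_stop_price hM hact
    exact hstopstep q hq1 hq2.le (fun u hu => absurd ⟨u, hu⟩ hin) hns hst

theorem State.IsConsistent.exists_finished (hM : M.IsAdmissible k lam xs ys)
    (h : s.IsConsistent M k lam xs ys) :
    ∃ s', Relation.ReflTransGen (M.Step k lam) s s' ∧ ∀ t, s'.item t = Phase.finished := by
  induction hn : s.remaining using Nat.strong_induction_on generalizing s with
  | _ n ih =>
    by_cases hfin : ∀ t, s.item t = Phase.finished
    · exact ⟨s, .refl, hfin⟩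
    · push Not at hfin
      obtain ⟨s1, hs1, hlt⟩ := h.exists_step hM hfin
      obtain ⟨s2, hs2, hf2⟩ := ih _ (hn ▸ hlt) (hs1.isConsistent hM h) rfl
      exact ⟨s2, .head hs1 hs2, hf2⟩

/-- The procedure can be carried out to its end. -/
theorem IsAdmissible.exists_isReturned (hM : M.IsAdmissible k lam xs ys) :
    ∃ s, M.IsReturned k lam xs ys s := by
  obtain ⟨l, hl⟩ : ∃ l, ∀ t, l < M.initialPrice ys t := by
    obtain ⟨b, hb⟩ := (Set.finite_range (M.initialPrice ys)).bddBelow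
    exact ⟨b - 1, fun t => (sub_one_lt b).trans_le (hb (mem_range_self t))⟩
  obtain ⟨s, hs, hf⟩ := (isConsistent_startState hM hl).exists_finished hM
  exact ⟨s, ⟨l, hl, hs⟩, hf⟩

end Market

/-! ### Revenue and welfare of envy-free solutions. -/

namespace Market

open Set Filter Topology MeasureTheory

variable {B S : Type*} [Fintype B] [Fintype S] {M : Market B S} {k lam : ℝ} {xs : B → ℝ}
  {ys : B → S → ℝ} {s : State B S} {p : S → ℝ} {x : B → ℝ} {y : B → S → ℝ}

section EnvyFree

theorem IsEnvyFree.isAllocation {B S : Type*} [Fintype S] {M : Market B S} {p : S → ℝ}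
    {x : B → ℝ} {y : B → S → ℝ} (h : M.IsEnvyFree p x y) : M.IsAllocation x y :=
  ⟨fun i => ⟨(h.bestResponse i).1, (h.bestResponse i).2.1⟩, h.flow⟩

theorem sum_mul_load (a : S → ℝ) (y : B → S → ℝ) :
    ∑ t, a t * load y t = ∑ i, ∑ t, a t * y i t := by
  simp only [load, Finset.mul_sum]
  exact Finset.sum_comm

theorem IsFlow.sum_mul_load_eq (h : M.IsFlow univ univ x y) {a : S → ℝ} {b : B → ℝ}
    (hab : ∀ i t, 0 < y i t → a t = b i) : ∑ t, a t * load y t = ∑ i, b i * x i := by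
  rw [sum_mul_load]
  refine Finset.sum_congr rfl fun i _ => ?_
  rw [← h.total i (mem_univ i), Finset.mul_sum]
  refine Finset.sum_congr rfl fun t _ => ?_
  by_cases hpos : 0 < y i t
  · rw [hab i t hpos]
  · rw [h.eq_zero hpos, mul_zero, mul_zero]

/-- Used with `a` the marginal costs of a terminal solution and `b` their minimum for each type: any
other flow pays at least these minima. -/
theorem IsFlow.le_sum_mul_load (h : M.IsFlow univ univ x y) {a : S → ℝ} {b : B → ℝ}
    (hab : ∀ i, ∀ t ∈ M.desired i, b i ≤ a t) : ∑ i, b i * x i ≤ ∑ t, a t * load y t := by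
  rw [sum_mul_load]
  refine Finset.sum_le_sum fun i _ => ?_
  rw [← h.total i (mem_univ i), Finset.mul_sum]
  refine Finset.sum_le_sum fun t _ => ?_
  by_cases hpos : 0 < y i t
  · exact mul_le_mul_of_nonneg_right (hab i t (h.mem_of_pos hpos).2.2) hpos.le
  · rw [h.eq_zero hpos, mul_zero, mul_zero]

theorem IsEnvyFree.revenue_eq (h : M.IsEnvyFree p x y) :
    M.revenue p y = ∑ i, M.minPrice p i * x i - M.totalCost y := by
  rw [revenue, Finset.sum_sub_distrib, h.flow.sum_mul_load_eq h.cheapest, totalCost]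

/-- The revenue of an envy-free solution is at most its welfare. -/
theorem IsEnvyFree.revenue_le_welfare (hdemand : ∀ i, M.IsInverseDemand i)
    (h : M.IsEnvyFree p x y) : M.revenue p y ≤ M.welfare x y := by
  rw [h.revenue_eq, welfare]
  refine sub_le_sub_right (Finset.sum_le_sum fun i _ => ?_) _
  obtain ⟨h0, hpop, hle, -⟩ := h.bestResponse i
  have := (hdemand i).le_integral le_rfl h0 hpop fun z hz hzx => hle z hz.le hzx
  rwa [sub_zero] at this

theorem IsWelfareOptimal.welfare_nonneg (hdemand : ∀ i, M.IsInverseDemand i)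
    (hcost : ∀ t, M.IsProductionCost t) (h : M.IsWelfareOptimal x y) : 0 ≤ M.welfare x y := by
  have h0 := h.2 0 0 ⟨fun i => ⟨le_rfl, by simpa using (hdemand i).pop_pos.le⟩,
    ⟨fun _ _ => le_rfl, fun _ _ => by simp, fun _ _ hne => absurd rfl hne⟩⟩
  have : M.welfare (0 : B → ℝ) (0 : B → S → ℝ) = 0 := by
    simp [welfare, totalCost, load, (hcost _).zero]
  rwa [this] at h0

theorem totalCost_tangent_le (hcost : ∀ t, M.IsProductionCost t) {y y' : B → S → ℝ}
    (hy : ∀ t, 0 ≤ load y t) (hy' : ∀ t, 0 ≤ load y' t) :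
    M.totalCost y + (∑ t, M.marginal t (load y t) * load y' t -
      ∑ t, M.marginal t (load y t) * load y t) ≤ M.totalCost y' := by
  rw [totalCost, totalCost, ← Finset.sum_sub_distrib, ← Finset.sum_add_distrib]
  refine Finset.sum_le_sum fun t _ => ?_
  have := (hcost t).tangent_le (hy t) (hy' t)
  linarith

end EnvyFree

/-! ### Terminal solutions and the two approximation bounds. -/

section Final

/-- The relation between price and marginal cost of a good that met the stopping criterion. -/
def IsStopMargin (k lam q c : ℝ) : Prop :=
  (lam ≤ q ∧ c = q) ∨ (q < lam ∧ q - c = 1 / k * (lam - c))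

/-- The relation makes `c` an increasing function of `q`: it is `(k * q - lam) / (k - 1) < lam`
below the peak and `q` itself from the peak on. The same `lam` for all goods is essential here. -/
theorem IsStopMargin.mono (hk : 1 < k) {q c q' c' : ℝ} (h : IsStopMargin k lam q c)
    (h' : IsStopMargin k lam q' c') (hq : q ≤ q') : c ≤ c' := by
  rcases h with ⟨h1, rfl⟩ | ⟨h1, h2⟩
  · rcases h' with ⟨-, rfl⟩ | ⟨h3, -⟩
    · exact hq
    · linarith
  · rcases h' with ⟨h3, rfl⟩ | ⟨-, h3⟩
    · exact ((lt_peak_of_margin_eq hk h2 h1).trans_le h3).le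
    · have hk' : 1 / k < 1 := (div_lt_one (one_pos.trans hk)).2 hk
      by_contra! hlt
      nlinarith

/-- What remains of the invariant when all goods are finished. -/
structure IsTerminal (M : Market B S) (k lam : ℝ) (xs : B → ℝ) (p : S → ℝ) (x : B → ℝ)
    (y : B → S → ℝ) : Prop where
  envyFree : M.IsEnvyFree p x y
  margin : ∀ t, IsStopMargin k lam (p t) (M.marginal t (load y t))
  le_opt : ∀ i, x i ≤ xs i
  eq_opt : ∀ i, lam ≤ M.minPrice p i → x i = xs i

theorem State.IsConsistent.isTerminal (hM : M.IsAdmissible k lam xs ys)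
    (h : s.IsConsistent M k lam xs ys) (hfin : ∀ t, s.item t = Phase.finished) :
    M.IsTerminal k lam xs s.price s.x s.y := by
  have hbuyer : ∀ i, M.IsBestResponse i (M.minPrice s.price i) (s.x i) ∧
      (∀ t, 0 < s.y i t → s.price t = M.minPrice s.price i) ∧ s.x i ≤ xs i ∧
      (lam ≤ M.minPrice s.price i → s.x i = xs i) := fun i => by
    cases hb : s.buyer i with
    | inactive =>
      obtain ⟨hx, hy, huse⟩ := h.buyer_inactive i hb
      have hnone : ∀ t, ¬ 0 < s.y i t := fun t ht => by simpa [hfin t] using huse t ht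
      have hx0 : s.x i = 0 := by
        rw [← h.flow.total i (mem_univ i)]
        exact Finset.sum_eq_zero fun t _ => h.flow.eq_zero (hnone t)
      -- A type that was never activated uses no good, so its optimal demand is `0`. Below the peak
      -- a best response is positive, so all its initial prices, and hence the final ones, are at
      -- least `lam`.
      have hP : lam ≤ M.minPrice (M.initialPrice ys) i := by
        by_contra! hlt
        have := (hM.envyFree.bestResponse i).pos (hM.demand i) (by rwa [hM.peak i])
        linarith
      have hlam : lam ≤ M.minPrice s.price i := Finset.le_inf' _ _ fun t ht =>
        (hP.trans (Finset.inf'_le _ ht)).trans (h.item_finished t (hfin t)).1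
      refine ⟨⟨hx0.ge, ?_, fun z hz hzx => absurd (hz.trans_lt hzx) (by simp [hx0]),
        fun z hz hzp => ?_⟩, fun t ht => absurd ht (hnone t), hx.le, fun _ => hx⟩
      · rw [hx0]; exact_mod_cast (hM.demand i).pop_pos.le
      · rw [hx0] at hz
        exact ((hM.demand i).val_le_zero ⟨hz.le, hzp⟩).trans ((hM.peak i).trans_le hlam)
    | active =>
      obtain ⟨t, ht⟩ := h.exists_active_item hb
      simp [hfin t] at ht
    | finished =>
      obtain ⟨q, hbr, hxs, hlam, huse, hdes, t, ht, -, hpt⟩ := h.buyer_finished i hb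
      have hq : M.minPrice s.price i = q := le_antisymm (hpt ▸ Finset.inf'_le _ ht)
        (Finset.le_inf' _ _ fun t ht => hdes t ht (hfin t))
      rw [hq]
      exact ⟨hbr, fun t ht => (huse t ht).2, hxs, hlam⟩
  exact ⟨⟨fun i => (hbuyer i).1, h.flow, fun i => (hbuyer i).2.1⟩,
    fun t => (h.item_finished t (hfin t)).2.2, fun i => (hbuyer i).2.2.1,
    fun i => (hbuyer i).2.2.2⟩

theorem IsReturned.isTerminal (hM : M.IsAdmissible k lam xs ys)
    (h : M.IsReturned k lam xs ys s) : M.IsTerminal k lam xs s.price s.x s.y := by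
  obtain ⟨⟨l, hl, hs⟩, hfin⟩ := h
  exact (isConsistent_of_reflTransGen hM (isConsistent_startState hM hl) hs).isTerminal hM hfin

/-- The marginal cost at which each buyer type is served in a terminal solution. -/
theorem IsTerminal.exists_buyerCost (hcost : ∀ t, M.IsProductionCost t) (hk : 1 < k)
    (h : M.IsTerminal k lam xs p x y) : ∃ γ : B → ℝ, ∀ i, 0 ≤ γ i ∧
      (∀ t ∈ M.desired i, γ i ≤ M.marginal t (load y t)) ∧
      (∀ t, 0 < y i t → M.marginal t (load y t) = γ i) ∧
      IsStopMargin k lam (M.minPrice p i) (γ i) := by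
  have hex : ∀ i, ∃ t ∈ M.desired i, M.minPrice p i = p t := fun i =>
    Finset.exists_mem_eq_inf' (M.desired_nonempty i) p
  -- `g i` is a cheapest desired good; by `IsStopMargin.mono` it also has least marginal cost, which
  -- serves as `γ i`.
  choose g hg hgp using hex
  have hle : ∀ i, ∀ t ∈ M.desired i,
      M.marginal (g i) (load y (g i)) ≤ M.marginal t (load y t) := fun i t ht =>
    (h.margin (g i)).mono hk (h.margin t) (by rw [← hgp]; exact Finset.inf'_le _ ht)
  refine ⟨fun i => M.marginal (g i) (load y (g i)), fun i =>
    ⟨(hcost _).marginal_nonneg (h.envyFree.flow.load_nonneg _), hle i, fun t ht => ?_,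
      by rw [hgp]; exact h.margin (g i)⟩⟩
  refine le_antisymm ?_ (hle i t (h.envyFree.flow.mem_of_pos ht).2.2)
  exact (h.margin t).mono hk (h.margin (g i)) (by rw [← hgp, h.envyFree.cheapest i t ht])

/-- The buyer types contribute `∑ (p̄ i - γ i) x i` to the revenue, the convexity of costs the
rest. -/
theorem IsEnvyFree.revenue_eq_add (h : M.IsEnvyFree p x y) {γ : B → ℝ}
    (hγ : ∀ i t, 0 < y i t → M.marginal t (load y t) = γ i) :
    M.revenue p y = ∑ i, (M.minPrice p i - γ i) * x i +
      (∑ t, M.marginal t (load y t) * load y t - M.totalCost y) := by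
  rw [h.revenue_eq, h.flow.sum_mul_load_eq hγ]
  simp only [sub_mul, Finset.sum_sub_distrib]
  ring

theorem totalCost_le_sum_marginal (hcost : ∀ t, M.IsProductionCost t)
    (hy : ∀ t, 0 ≤ load y t) : M.totalCost y ≤ ∑ t, M.marginal t (load y t) * load y t :=
  Finset.sum_le_sum fun t _ => (hcost t).cost_le_marginal_mul (hy t)

/-- The welfare lost in a terminal solution is at most its revenue. -/
theorem IsTerminal.welfare_sub_le_revenue (hM : M.IsAdmissible (Real.exp 1) lam xs ys)
    (hall : M.IsAllocation xs ys) (h : M.IsTerminal (Real.exp 1) lam xs p x y) :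
    M.welfare xs ys - M.welfare x y ≤ M.revenue p y := by
  obtain ⟨γ, hγ⟩ := h.exists_buyerCost hM.cost hM.one_lt
  have hbuyer : ∀ i, (∫ z in (0 : ℝ)..(xs i), M.val i z) - ∫ z in (0 : ℝ)..(x i), M.val i z ≤
      (γ i * xs i - γ i * x i) + (M.minPrice p i - γ i) * x i := fun i => by
    obtain ⟨h0, -, -, hmargin⟩ := hγ i
    have hbr := h.envyFree.bestResponse i
    rcases hmargin with ⟨hle, -⟩ | ⟨hlt, heq⟩
    · rcases (hγ i).2.2.2 with ⟨-, h2⟩ | ⟨h2, -⟩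
      · rw [h.eq_opt i hle, h2]; simp
      · linarith
    · rw [(hM.demand i).integral_sub_integral hbr.1 (h.le_opt i) (hall.1 i).2]
      have := hbr.integral_le (hM.demand i) (hM.mhr i) h0 (by rwa [hM.peak i])
        (by rwa [hM.peak i]) (h.le_opt i) (hall.1 i).2
      linarith
  have hsum := Finset.sum_le_sum fun i (_ : i ∈ Finset.univ) => hbuyer i
  simp only [Finset.sum_sub_distrib, Finset.sum_add_distrib] at hsum
  have hy := h.envyFree.flow.load_nonneg
  -- Linearized at the terminal loads and regrouped by types, the extra cost of the optimum is at
  -- least `∑ γ i * (xs i - x i)`, which cancels the cost terms in `hbuyer`.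
  have hcost := totalCost_tangent_le hM.cost hy hall.2.load_nonneg
  have h1 := hall.2.le_sum_mul_load (a := fun t => M.marginal t (load y t)) fun i => (hγ i).2.1
  have h2 := h.envyFree.flow.sum_mul_load_eq (a := fun t => M.marginal t (load y t))
    fun i => (hγ i).2.2.1
  have h3 := totalCost_le_sum_marginal hM.cost hy
  rw [h.envyFree.revenue_eq_add fun i => (hγ i).2.2.1, welfare, welfare]
  linarith

/-- A terminal solution extracts a fraction `1 / e` of the revenue of every envy-free solution. -/
theorem IsTerminal.revenue_le (hM : M.IsAdmissible (Real.exp 1) lam xs ys)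
    (h : M.IsTerminal (Real.exp 1) lam xs p x y) {p' : S → ℝ} {x' : B → ℝ} {y' : B → S → ℝ}
    (h' : M.IsEnvyFree p' x' y') : M.revenue p' y' ≤ Real.exp 1 * M.revenue p y := by
  obtain ⟨γ, hγ⟩ := h.exists_buyerCost hM.cost hM.one_lt
  have hbuyer : ∀ i, (M.minPrice p' i - γ i) * x' i ≤
      Real.exp 1 * ((M.minPrice p i - γ i) * x i) := fun i => by
    obtain ⟨h0, -, -, hmargin⟩ := hγ i
    have hbr := h.envyFree.bestResponse i
    have hbr' := h'.bestResponse i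
    rcases hmargin with ⟨hle, heq⟩ | ⟨hlt, heq⟩
    · rw [heq, sub_self, zero_mul, mul_zero]
      -- Here `γ i` is at least the peak, so any price at which type `i` buys has nonpositive
      -- margin.
      rcases hbr'.1.eq_or_lt with hx | hx
      · rw [← hx, mul_zero]
      · have := hbr'.2.2.1 0 le_rfl hx
        rw [hM.peak i] at this
        exact mul_nonpos_of_nonpos_of_nonneg (by linarith) hx.le
    · exact hbr.margin_mul_le (hM.demand i) (hM.mhr i) h0 (by rwa [hM.peak i])
        (by rwa [hM.peak i]) hbr'
  have hsum := Finset.sum_le_sum fun i (_ : i ∈ Finset.univ) => hbuyer i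
  rw [← Finset.mul_sum] at hsum
  simp only [sub_mul _ _ (x' _), Finset.sum_sub_distrib] at hsum
  have hy := h.envyFree.flow.load_nonneg
  have hcost := totalCost_tangent_le hM.cost hy h'.flow.load_nonneg
  have h1 := h'.flow.le_sum_mul_load (a := fun t => M.marginal t (load y t)) fun i => (hγ i).2.1
  have h3 := totalCost_le_sum_marginal hM.cost hy
  rw [h.envyFree.revenue_eq_add fun i => (hγ i).2.2.1, h'.revenue_eq, mul_add]
  -- The convexity surplus `∑ c_t y_t - C(y)` enters the bound for the other revenue once and the
  -- right-hand side `e ≥ 1` times.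
  have h4 := le_mul_of_one_le_left (sub_nonneg.2 h3) hM.one_lt.le
  linarith

end Final

end Market

/-! ### Combining the two bounds. -/

theorem mainTheorem11 {B S : Type*} [Fintype B] [Fintype S] (M : Market B S) (lam : ℝ)
    (hdemand : ∀ i, M.IsInverseDemand i) (hmhr : ∀ i, M.IsMHR i)
    (hpeak : M.HasUniformPeak lam) (hcost : ∀ t, M.IsProductionCost t)
    (xs : B → ℝ) (ys : B → S → ℝ) (hopt : M.IsWelfareOptimal xs ys) :
    (∃ s, M.IsReturned (Real.exp 1) lam xs ys s) ∧
    ∀ s, M.IsReturned (Real.exp 1) lam xs ys s →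
      M.IsEnvyFree s.price s.x s.y ∧
      ∃ α ∈ Set.Icc (1 : ℝ) 2,
        M.welfare s.x s.y = 1 / α * M.welfare xs ys ∧
        ∀ p x y, M.IsEnvyFree p x y →
          max (1 / Real.exp 1) ((α - 1) / α) * M.revenue p y ≤ M.revenue s.price s.y := by
  have hM : M.IsAdmissible (Real.exp 1) lam xs ys :=
    ⟨hdemand, hmhr, hpeak.2, hcost, Real.one_lt_exp_iff.2 one_pos, hopt.isEnvyFree hdemand hcost⟩
  refine ⟨hM.exists_isReturned, fun s hs => ?_⟩
  have h := hs.isTerminal hM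
  refine ⟨h.envyFree, ?_⟩
  have hloss := h.welfare_sub_le_revenue hM hopt.1
  have hrev := h.envyFree.revenue_le_welfare hdemand
  have hle := hopt.2 _ _ h.envyFree.isAllocation
  have hnn := hopt.welfare_nonneg hdemand hcost
  have hopt_rev : ∀ p x y, M.IsEnvyFree p x y → M.revenue p y ≤ M.welfare xs ys :=
    fun p x y hE => (hE.revenue_le_welfare hdemand).trans (hopt.2 _ _ hE.isAllocation)
  have he : ∀ p x y, M.IsEnvyFree p x y →
      1 / Real.exp 1 * M.revenue p y ≤ M.revenue s.price s.y := fun p x y hE => by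
    rw [one_div, inv_mul_le_iff₀ (Real.exp_pos 1)]
    exact h.revenue_le hM hE
  have hmax : ∀ a b r R : ℝ, a * r ≤ R → b * r ≤ R → max a b * r ≤ R := fun a b r R ha hb => by
    rcases max_choice a b with hab | hab <;> rwa [hab]
  -- If the optimal welfare is `0`, then the terminal welfare is also `0` and `α = 1` works;
  -- otherwise `W* - W ≤ R ≤ W` makes `W` positive and `α = W* / W` is defined.
  rcases hnn.eq_or_lt with h0 | hpos
  · refine ⟨1, by norm_num, by linarith, fun p x y hE => hmax _ _ _ _ (he p x y hE) ?_⟩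
    rw [sub_self, zero_div, zero_mul]
    linarith
  · have hw : 0 < M.welfare s.x s.y := by linarith
    refine ⟨M.welfare xs ys / M.welfare s.x s.y,
      ⟨(one_le_div hw).2 hle, (div_le_iff₀ hw).2 (by linarith)⟩, by field_simp,
      fun p x y hE => hmax _ _ _ _ (he p x y hE) ?_⟩
    have hα : (M.welfare xs ys / M.welfare s.x s.y - 1) / (M.welfare xs ys / M.welfare s.x s.y) =
        (M.welfare xs ys - M.welfare s.x s.y) / M.welfare xs ys := by field_simp
    rw [hα, div_mul_eq_mul_div, div_le_iff₀ hpos]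
    -- The other revenue is at most `W*`, and the factor `W* - W` is at most the terminal revenue.
    calc _ ≤ (M.welfare xs ys - M.welfare s.x s.y) * M.welfare xs ys :=
          mul_le_mul_of_nonneg_left (hopt_rev p x y hE) (sub_nonneg.2 hle)
      _ ≤ _ := mul_le_mul_of_nonneg_right hloss hpos.le
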